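/- Let $\mathcal H$ be a complex Hilbert space and let $\mathfrak C_1^{\rm sa}$ be the real Banach space of self-adjoint trace-class operators on $\mathcal H$ with the trace norm. For $u \in \mathfrak C_1^{\rm sa}$ write $u \ge 0$ if $(ux,x) \ge 0$ for all $x \in \mathcal H$. For a linear operator $A \colon D(A) \to \mathfrak C_1^{\rm sa}$ with $D(A) \subset \mathfrak C_1^{\rm sa}$ write $D(A)^+ = \{u \in D(A) : u \ge 0\}$. The operator $A$ is called positivity preserving, written $A \ge 0$, if $Au \ge 0$ for all $u \in D(A)^+$. For operators $A, B$ with the same domain, $A \le B$ means $B - A \ge 0$. A semigroup is called positivity preserving if all its members are. Let $-H$ be the generator of a positivity preserving contraction $C_0$-semigroup on $\mathfrak C_1^{\rm sa}$. Let $K \colon D(H) \to \mathfrak C_1^{\rm sa}$ be a positivity preserving linear operator such that $\operatorname{Tr}(Ku) \le \operatorname{Tr}(Hu)$ for all $u \in D(H)^+$. Let $(K_\alpha)_{\alpha \in J}$ be a functional regularisation of $K$, that is, a net of linear operators $K_\alpha \colon D(H) \to \mathfrak C_1^{\rm sa}$ such that 1. $K_\alpha$ is positivity preserving for all $\alpha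 \in J$; 2. for all $\alpha \in J$ there are $a_\alpha \in [0,\infty)$ and $b_\alpha \in [0,1)$ with $\operatorname{Tr}(K_\alpha u) \le a_\alpha \operatorname{Tr} u + b_\alpha \operatorname{Tr}(Hu)$ for all $u \in D(H)^+$; 3. $K_\alpha \le K_\beta \le K$ for all $\alpha, \beta \in J$ with $\alpha \le \beta$; 4. for all $u \in D(H)^+$ there is a dense subspace $V$ of $\mathcal H$ such that $\lim_\alpha ((K_\alpha u)x,x) = ((Ku)x,x)$ for all $x \in V$. Let $(T_t)_{t>0}$ be the family constructed from this data: $T_t u = \lim_\alpha T^\alpha_t u$ for all $t > 0$ and $u \in \mathfrak C_1^{\rm sa}$, where $(T^\alpha_t)_{t>0}$ is the $C_0$-semigroup generated by $-(H - K_\alpha)$, with $D(H-K_\alpha) = D(H)$. (These semigroups and limits exist, and $(T_t)_{t>0}$ is a positivity preserving contraction $C_0$-semigroup on $\mathfrak C_1^{\rm sa}$.) Then $(T_t)_{t>0}$ is minimal in the following sense. If $L'$ is an extension of the operator $H - K$ with domain $D(H)$ such that $-L'$ generates a positivity preserving $C_0$-semigroup $(T'_t)_{t>0}$ on $\mathfrak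 C_1^{\rm sa}$, then $T'_t \ge T_t$ for all $t > 0$. -/

import Mathlib

open Filter Topology
open scoped InnerProductSpace ENNReal

noncomputable section

namespace TraceClass

variable {ℋ : Type*} [NormedAddCommGroup ℋ] [InnerProductSpace ℂ ℋ] [CompleteSpace ℋ]

/-- The diagonal sum `∑ᵢ ⟪bᵢ, a bᵢ⟫ ∈ [0, ∞]` of a (positive) operator in a Hilbert basis. -/
def diagSum {ι : Type*} (b : HilbertBasis ι ℂ ℋ) (a : ℋ →L[ℂ] ℋ) : ℝ≥0∞ :=
  ∑' i, ENNReal.ofReal (⟪b i, a (b i)⟫_ℂ).re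

variable (ℋ) in
/-- The index set of a fixed Hilbert basis of `ℋ`. -/
def stdIndex : Set ℋ := (exists_hilbertBasis ℂ ℋ).choose

variable (ℋ) in
/-- A fixed Hilbert basis of `ℋ`. -/
def stdBasis : HilbertBasis (stdIndex ℋ) ℂ ℋ := (exists_hilbertBasis ℂ ℋ).choose_spec.choose

/-- The trace norm `Tr |u| ∈ [0, ∞]`, where `|u| = (u* u)^{1/2}`.  It is independent of the
Hilbert basis by `diagSum_eq`. -/
def traceNorm (u : ℋ →L[ℂ] ℋ) : ℝ≥0∞ := diagSum (stdBasis ℋ) (CFC.abs u)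

lemma inner_eq_norm_sqrt {a : ℋ →L[ℂ] ℋ} (ha : 0 ≤ a) (x : ℋ) :
    (⟪x, a x⟫_ℂ).re = ‖CFC.sqrt a x‖ ^ 2 := by
  have hs : CFC.sqrt a * CFC.sqrt a = a := CFC.sqrt_mul_sqrt_self a
  have hsym : (CFC.sqrt a).IsPositive :=
    (ContinuousLinearMap.nonneg_iff_isPositive _).1 (CFC.sqrt_nonneg a)
  have h1 : a x = CFC.sqrt a (CFC.sqrt a x) := by
    rw [← mul_apply_eq_comp, hs]
  rw [h1, ← hsym.inner_left_eq_inner_right, inner_self_eq_norm_sq_to_K]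
  norm_cast

lemma diag_nonneg {a : ℋ →L[ℂ] ℋ} (ha : 0 ≤ a) (x : ℋ) : 0 ≤ (⟪x, a x⟫_ℂ).re := by
  rw [inner_eq_norm_sqrt ha]; positivity

lemma ofReal_norm_sq_eq_tsum {ι : Type*} (b : HilbertBasis ι ℂ ℋ) (x : ℋ) :
    ENNReal.ofReal (‖x‖ ^ 2) = ∑' i, ENNReal.ofReal (‖⟪b i, x⟫_ℂ‖ ^ 2) := by
  have h := b.hasSum_inner_mul_inner x x
  have h2 : HasSum (fun i => ‖⟪b i, x⟫_ℂ‖ ^ 2) (‖x‖ ^ 2) := by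
    have h3 := Complex.hasSum_re h
    rw [inner_self_eq_norm_sq_to_K] at h3
    convert h3 using 1
    · funext i
      rw [← inner_conj_symm x (b i), mul_comm, Complex.mul_conj, Complex.normSq_eq_norm_sq]
      norm_cast
    · norm_cast
  rw [← h2.tsum_eq, ENNReal.ofReal_tsum_of_nonneg (fun i => by positivity) h2.summable]

/-- The trace of a positive operator does not depend on the Hilbert basis. -/
theorem diagSum_eq {ι κ : Type*} (b : HilbertBasis ι ℂ ℋ) (c : HilbertBasis κ ℂ ℋ)
    {a : ℋ →L[ℂ] ℋ} (ha : 0 ≤ a) : diagSum b a = diagSum c a := by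
  have hsym : (CFC.sqrt a).IsPositive :=
    (ContinuousLinearMap.nonneg_iff_isPositive _).1 (CFC.sqrt_nonneg a)
  unfold diagSum
  simp_rw [inner_eq_norm_sqrt ha]
  calc ∑' i, ENNReal.ofReal (‖CFC.sqrt a (b i)‖ ^ 2)
      = ∑' i, ∑' j, ENNReal.ofReal (‖⟪c j, CFC.sqrt a (b i)⟫_ℂ‖ ^ 2) :=
        tsum_congr fun i => ofReal_norm_sq_eq_tsum c _
    _ = ∑' j, ∑' i, ENNReal.ofReal (‖⟪c j, CFC.sqrt a (b i)⟫_ℂ‖ ^ 2) := ENNReal.tsum_comm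
    _ = ∑' j, ∑' i, ENNReal.ofReal (‖⟪b i, CFC.sqrt a (c j)⟫_ℂ‖ ^ 2) := by
        refine tsum_congr fun j => tsum_congr fun i => ?_
        rw [← hsym.inner_left_eq_inner_right, norm_inner_symm]
    _ = ∑' j, ENNReal.ofReal (‖CFC.sqrt a (c j)‖ ^ 2) :=
        tsum_congr fun j => (ofReal_norm_sq_eq_tsum b _).symm

lemma traceNorm_eq {ι : Type*} (b : HilbertBasis ι ℂ ℋ) (u : ℋ →L[ℂ] ℋ) :
    traceNorm u = diagSum b (CFC.abs u) := diagSum_eq _ _ (CFC.abs_nonneg u)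

/-- A Hilbert basis adapted to the decomposition of a self-adjoint operator in its positive and
negative part. -/
lemma exists_adapted_basis (w : ℋ →L[ℂ] ℋ) :
    ∃ (ι : Set ℋ) (b : HilbertBasis ι ℂ ℋ), ∀ i, w⁻ (b i) = 0 ∨ w⁺ (b i) = 0 := by
  have hsym : (w⁺).IsPositive :=
    (ContinuousLinearMap.nonneg_iff_isPositive _).1 (CFC.posPart_nonneg w)
  let M : Submodule ℂ ℋ := LinearMap.ker (w⁻ : ℋ →L[ℂ] ℋ).toLinearMap
  have hMc : IsClosed (M : Set ℋ) := (w⁻ : ℋ →L[ℂ] ℋ).isClosed_ker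
  have : CompleteSpace M := hMc.completeSpace_coe
  have hM : ∀ x, x ∈ M ↔ w⁻ x = 0 := fun x => LinearMap.mem_ker
  obtain ⟨s, b0, hb0⟩ := exists_hilbertBasis ℂ M
  have ho : Orthonormal ℂ (fun i : s => ((b0 i : M) : ℋ)) :=
    b0.orthonormal.comp_linearIsometry M.subtypeₗᵢ
  have ho' := ho.toSubtypeRange
  obtain ⟨ι, b, hsub, hb⟩ := ho'.exists_hilbertBasis_extension
  refine ⟨ι, b, fun i => ?_⟩
  by_cases hi : (i : ℋ) ∈ Set.range (fun i : s => ((b0 i : M) : ℋ))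
  · left
    obtain ⟨j, hj⟩ := hi
    rw [hb, ← hj]
    exact (hM _).1 (b0 j).2
  · right
    have hperp : ∀ y : M, ⟪b i, (y : ℋ)⟫_ℂ = 0 := by
      intro y
      have h1 := (b0.hasSum_repr y).mapL ((innerSL ℂ (b i)).comp M.subtypeL)
      have h2 : ∀ j, ((innerSL ℂ (b i)).comp M.subtypeL) (b0.repr y j • b0 j) = 0 := by
        intro j
        have hj : ((b0 j : M) : ℋ) ∈ ι := hsub ⟨j, rfl⟩
        have hne : i ≠ ⟨_, hj⟩ := by
          rintro rfl
          exact hi ⟨j, rfl⟩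
        have h4 : b ⟨_, hj⟩ = ((b0 j : M) : ℋ) := by rw [hb]
        have h5 : ⟪b i, ((b0 j : M) : ℋ)⟫_ℂ = 0 := h4 ▸ b.orthonormal.2 hne
        simp [h5]
      have h3 := h1.unique (by simpa only [h2] using hasSum_zero)
      simpa using h3
    have hz : ⟪w⁺ (b i), w⁺ (b i)⟫_ℂ = 0 := by
      rw [hsym.inner_left_eq_inner_right]
      refine hperp ⟨w⁺ (w⁺ (b i)), (hM _).2 ?_⟩
      rw [← mul_apply_eq_comp, CFC.negPart_mul_posPart]
      rfl
    exact inner_self_eq_zero.1 hz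

lemma abs_diag_le {u : ℋ →L[ℂ] ℋ} (hu : IsSelfAdjoint u) (x : ℋ) :
    |(⟪x, u x⟫_ℂ).re| ≤ (⟪x, CFC.abs u x⟫_ℂ).re := by
  have h1 := diag_nonneg (CFC.posPart_nonneg u) x
  have h2 := diag_nonneg (CFC.negPart_nonneg u) x
  have e1 : u x = u⁺ x - u⁻ x := by
    conv_lhs => rw [← CFC.posPart_sub_negPart u hu]
    rfl
  have e2 : CFC.abs u x = u⁺ x + u⁻ x := by
    rw [← CFC.posPart_add_negPart u hu]
    rfl
  rw [e1, e2, inner_sub_right, inner_add_right, Complex.sub_re, Complex.add_re, abs_le]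
  constructor <;> linarith

lemma traceNorm_add_le {u v : ℋ →L[ℂ] ℋ} (hu : IsSelfAdjoint u) (hv : IsSelfAdjoint v) :
    traceNorm (u + v) ≤ traceNorm u + traceNorm v := by
  obtain ⟨ι, b, hb⟩ := exists_adapted_basis (u + v)
  have hw := hu.add hv
  rw [traceNorm_eq b, traceNorm_eq b, traceNorm_eq b]
  unfold diagSum
  rw [← ENNReal.tsum_add]
  refine ENNReal.tsum_le_tsum fun i => ?_
  have hpu := diag_nonneg (CFC.abs_nonneg u) (b i)
  have hpv := diag_nonneg (CFC.abs_nonneg v) (b i)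
  rw [← ENNReal.ofReal_add hpu hpv]
  refine ENNReal.ofReal_le_ofReal ?_
  have key : (⟪b i, CFC.abs (u + v) (b i)⟫_ℂ).re = |(⟪b i, (u + v) (b i)⟫_ℂ).re| := by
    have e1 : (u + v) (b i) = (u + v)⁺ (b i) - (u + v)⁻ (b i) := by
      conv_lhs => rw [← CFC.posPart_sub_negPart (u + v) hw]
      rfl
    have e2 : CFC.abs (u + v) (b i) = (u + v)⁺ (b i) + (u + v)⁻ (b i) := by
      rw [← CFC.posPart_add_negPart (u + v) hw]
      rfl
    have h1 := diag_nonneg (CFC.posPart_nonneg (u + v)) (b i)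
    have h2 := diag_nonneg (CFC.negPart_nonneg (u + v)) (b i)
    rw [e1, e2]
    rcases hb i with h | h
    · rw [h, add_zero, sub_zero, abs_of_nonneg h1]
    · rw [h, zero_add, zero_sub, inner_neg_right, Complex.neg_re, abs_neg, abs_of_nonneg h2]
  rw [key, add_apply, inner_add_right, Complex.add_re]
  exact (abs_add_le _ _).trans (add_le_add (abs_diag_le hu _) (abs_diag_le hv _))

lemma traceNorm_smul (r : ℝ) (u : ℋ →L[ℂ] ℋ) :
    traceNorm (r • u) = ENNReal.ofReal |r| * traceNorm u := by
  unfold traceNorm diagSum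
  rw [← ENNReal.tsum_mul_left]
  refine tsum_congr fun i => ?_
  rw [CFC.abs_smul r u, ← ENNReal.ofReal_mul (abs_nonneg r), Real.norm_eq_abs]
  congr 1
  rw [smul_apply, inner_smul_right_eq_smul]
  simp

lemma traceNorm_zero : traceNorm (0 : ℋ →L[ℂ] ℋ) = 0 := by
  simp [traceNorm, diagSum]

lemma eq_zero_of_traceNorm {u : ℋ →L[ℂ] ℋ} (h : traceNorm u = 0) : u = 0 := by
  unfold traceNorm diagSum at h
  rw [ENNReal.tsum_eq_zero] at h
  have hs : CFC.sqrt (CFC.abs u) = 0 := by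
    refine ContinuousLinearMap.ext_on (s := Set.range (stdBasis ℋ)) ?_ ?_
    · exact (Submodule.dense_iff_topologicalClosure_eq_top).2 (stdBasis ℋ).dense_span
    · rintro _ ⟨i, rfl⟩
      have := ENNReal.ofReal_eq_zero.1 (h i)
      rw [inner_eq_norm_sqrt (CFC.abs_nonneg u)] at this
      have h0 : ‖CFC.sqrt (CFC.abs u) (stdBasis ℋ i)‖ = 0 := by
        have := sq_nonneg ‖CFC.sqrt (CFC.abs u) (stdBasis ℋ i)‖
        exact pow_eq_zero_iff (n := 2) (by norm_num) |>.1 (by linarith)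
      simpa using h0
  have : CFC.abs u = 0 := by
    rw [← CFC.sqrt_mul_sqrt_self (CFC.abs u) (CFC.abs_nonneg u), hs, zero_mul]
  exact CFC.abs_eq_zero_iff.1 this

variable (ℋ) in
/-- The real vector space of self-adjoint trace-class operators on `ℋ`, i.e. of the self-adjoint
bounded operators `u` with `Tr |u| < ∞`. -/
def saSubmodule : Submodule ℝ (ℋ →L[ℂ] ℋ) where
  carrier := {u | IsSelfAdjoint u ∧ traceNorm u ≠ ∞}
  zero_mem' := ⟨IsSelfAdjoint.zero _, by simp [traceNorm_zero]⟩
  add_mem' := fun {u v} hu hv => ⟨hu.1.add hv.1,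
    ne_top_of_le_ne_top (ENNReal.add_ne_top.2 ⟨hu.2, hv.2⟩) (traceNorm_add_le hu.1 hv.1)⟩
  smul_mem' := fun r u hu => ⟨IsSelfAdjoint.smul (IsSelfAdjoint.all r) hu.1, by
    rw [traceNorm_smul]; exact ENNReal.mul_ne_top ENNReal.ofReal_ne_top hu.2⟩

end TraceClass

open TraceClass

/-- The Banach space over `ℝ` of self-adjoint trace-class operators on the complex Hilbert space
`ℋ`, with the trace norm (not the operator norm). -/
def SATraceClass (ℋ : Type*) [NormedAddCommGroup ℋ] [InnerProductSpace ℂ ℋ] [CompleteSpace ℋ] :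
    Type _ := ↥(saSubmodule ℋ)

namespace SATraceClass

variable {ℋ : Type*} [NormedAddCommGroup ℋ] [InnerProductSpace ℂ ℋ] [CompleteSpace ℋ]

instance : AddCommGroup (SATraceClass ℋ) := inferInstanceAs (AddCommGroup ↥(saSubmodule ℋ))

instance : Module ℝ (SATraceClass ℋ) := inferInstanceAs (Module ℝ ↥(saSubmodule ℋ))

/-- The underlying bounded operator of a self-adjoint trace-class operator. -/
def toOp : SATraceClass ℋ →ₗ[ℝ] (ℋ →L[ℂ] ℋ) := (saSubmodule ℋ).subtype

lemma toOp_injective : Function.Injective (toOp (ℋ := ℋ)) := Subtype.val_injective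

lemma isSelfAdjoint_toOp (u : SATraceClass ℋ) : IsSelfAdjoint (toOp u) := u.2.1

lemma traceNorm_toOp_ne_top (u : SATraceClass ℋ) : traceNorm (toOp u) ≠ ∞ := u.2.2

/-- The trace norm `‖u‖ = Tr |u|`. -/
instance : Norm (SATraceClass ℋ) := ⟨fun u => (traceNorm (toOp u)).toReal⟩

lemma norm_def (u : SATraceClass ℋ) : ‖u‖ = (traceNorm (toOp u)).toReal := rfl

lemma normedSpaceCore : NormedSpace.Core ℝ (SATraceClass ℋ) where
  norm_nonneg u := ENNReal.toReal_nonneg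
  norm_smul r u := by
    rw [norm_def, norm_def, map_smul, traceNorm_smul, ENNReal.toReal_mul,
      ENNReal.toReal_ofReal (abs_nonneg r), Real.norm_eq_abs]
  norm_triangle u v := by
    rw [norm_def, norm_def, norm_def, map_add, ← ENNReal.toReal_add (traceNorm_toOp_ne_top u)
      (traceNorm_toOp_ne_top v)]
    exact ENNReal.toReal_mono (ENNReal.add_ne_top.2 ⟨traceNorm_toOp_ne_top u,
      traceNorm_toOp_ne_top v⟩) (traceNorm_add_le (isSelfAdjoint_toOp u) (isSelfAdjoint_toOp v))
  norm_eq_zero_iff u := by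
    rw [norm_def, ENNReal.toReal_eq_zero_iff, or_iff_left (traceNorm_toOp_ne_top u)]
    refine ⟨fun h => toOp_injective ?_, fun h => ?_⟩
    · rw [map_zero]; exact eq_zero_of_traceNorm h
    · rw [h, map_zero]; exact traceNorm_zero

instance : NormedAddCommGroup (SATraceClass ℋ) := NormedAddCommGroup.ofCore normedSpaceCore

instance : NormedSpace ℝ (SATraceClass ℋ) := NormedSpace.ofCore normedSpaceCore

/-- The order `u ≤ v ↔ v - u` is a positive operator. -/
instance : PartialOrder (SATraceClass ℋ) := PartialOrder.lift toOp toOp_injective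

open scoped ComplexOrder in
lemma nonneg_iff (u : SATraceClass ℋ) : 0 ≤ u ↔ ∀ x : ℋ, 0 ≤ ⟪toOp u x, x⟫_ℂ := by
  change toOp (0 : SATraceClass ℋ) ≤ toOp u ↔ _
  rw [map_zero, ContinuousLinearMap.nonneg_iff_isPositive]
  exact ContinuousLinearMap.isPositive_iff_complex _ |>.trans (by
    refine forall_congr' fun x => ?_
    rw [Complex.nonneg_iff, Complex.ext_iff]
    simp [and_comm])

/-- The trace of a self-adjoint trace-class operator. -/
def tr (u : SATraceClass ℋ) : ℝ := ∑' i, (⟪stdBasis ℋ i, toOp u (stdBasis ℋ i)⟫_ℂ).re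

end SATraceClass

/-- A linear operator with domain a subspace `D` is positivity preserving if it maps positive
elements of `D` to positive elements. -/
def PositivityPreserving {ℋ : Type*} [NormedAddCommGroup ℋ] [InnerProductSpace ℂ ℋ]
    [CompleteSpace ℋ] {D : Submodule ℝ (SATraceClass ℋ)} (A : D →ₗ[ℝ] SATraceClass ℋ) : Prop :=
  ∀ u : D, 0 ≤ (u : SATraceClass ℋ) → 0 ≤ A u

/-- The order on everywhere defined bounded operators: `S ≤ T` if `T - S` is positivity
preserving. -/
def OperatorLE {ℋ : Type*} [NormedAddCommGroup ℋ] [InnerProductSpace ℂ ℋ]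
    [CompleteSpace ℋ] (S T : SATraceClass ℋ →L[ℝ] SATraceClass ℋ) : Prop :=
  ∀ u : SATraceClass ℋ, 0 ≤ u → 0 ≤ (T - S) u

/-- A `C₀`-semigroup `(T t)_{t > 0}` of bounded operators on a normed space; the values `T t` for
`t ≤ 0` play no role. -/
structure IsC0Semigroup {X : Type*} [NormedAddCommGroup X] [NormedSpace ℝ X]
    (T : ℝ → X →L[ℝ] X) : Prop where
  add : ∀ s t : ℝ, 0 < s → 0 < t → T (s + t) = (T s).comp (T t)
  tendsto_zero : ∀ u : X, Tendsto (fun t => T t u) (𝓝[>] 0) (𝓝 u)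

/-- `A` is the infinitesimal generator of `(T t)_{t > 0}`: the domain of `A` consists of all `u` for
which `lim_{t ↓ 0} (T t u - u) / t` exists, and `A u` is this limit. -/
def IsGeneratorOf {X : Type*} [NormedAddCommGroup X] [NormedSpace ℝ X]
    (A : X →ₗ.[ℝ] X) (T : ℝ → X →L[ℝ] X) : Prop :=
  ∀ u v : X, (u, v) ∈ A.graph ↔
    Tendsto (fun t : ℝ => t⁻¹ • (T t u - u)) (𝓝[>] 0) (𝓝 v)

/-- The operator `H - K` with domain `D(H)`. -/
def subOnDomain {X : Type*} [NormedAddCommGroup X] [NormedSpace ℝ X]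
    (H : X →ₗ.[ℝ] X) (K : H.domain →ₗ[ℝ] X) : X →ₗ.[ℝ] X :=
  ⟨H.domain, H.toFun - K⟩

section

variable {ℋ : Type*} [NormedAddCommGroup ℋ] [InnerProductSpace ℂ ℋ] [CompleteSpace ℋ]

/-- A semigroup is positivity preserving if every `T t` with `t > 0` is. -/
def PositiveSemigroup (T : ℝ → SATraceClass ℋ →L[ℝ] SATraceClass ℋ) : Prop :=
  ∀ t : ℝ, 0 < t → ∀ u : SATraceClass ℋ, 0 ≤ u → 0 ≤ T t u

/-- A dynamical semigroup: a positivity preserving contraction `C₀`-semigroup. -/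
structure IsDynamicalSemigroup (T : ℝ → SATraceClass ℋ →L[ℝ] SATraceClass ℋ) : Prop where
  isC0Semigroup : IsC0Semigroup T
  positive : PositiveSemigroup T
  contraction : ∀ t : ℝ, 0 < t → ‖T t‖ ≤ 1

/-- The net `(K_α)` is a functional regularisation of the operator `K : D(H) → 𝔠₁ˢᵃ`. -/
structure IsFunctionalRegularisation (H : SATraceClass ℋ →ₗ.[ℝ] SATraceClass ℋ)
    (K : H.domain →ₗ[ℝ] SATraceClass ℋ) {J : Type*} [Preorder J]
    (Kα : J → H.domain →ₗ[ℝ] SATraceClass ℋ) : Prop where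
  positive : ∀ α, PositivityPreserving (Kα α)
  relative_bound : ∀ α, ∃ a b : ℝ, 0 ≤ a ∧ 0 ≤ b ∧ b < 1 ∧
    ∀ u : H.domain, 0 ≤ (u : SATraceClass ℋ) →
      (Kα α u).tr ≤ a * (u : SATraceClass ℋ).tr + b * (H u).tr
  monotone : ∀ α β, α ≤ β → PositivityPreserving (Kα β - Kα α)
  le : ∀ α, PositivityPreserving (K - Kα α)
  tendsto : ∀ u : H.domain, 0 ≤ (u : SATraceClass ℋ) →
    ∃ V : Submodule ℂ ℋ, Dense (V : Set ℋ) ∧ ∀ x ∈ V,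
      Tendsto (fun α => ⟪(Kα α u).toOp x, x⟫_ℂ) atTop (𝓝 ⟪(K u).toOp x, x⟫_ℂ)

/-- `(T t)_{t > 0}` is constructed from the net `(K_α)`: `T t u = lim_α T^α t u` for all `t > 0` and
all `u`, where `(T^α t)_{t > 0}` is the `C₀`-semigroup generated by `-(H - K_α)`. -/
def IsRegularisationLimit (H : SATraceClass ℋ →ₗ.[ℝ] SATraceClass ℋ) {J : Type*} [Preorder J]
    (Kα : J → H.domain →ₗ[ℝ] SATraceClass ℋ)
    (T : ℝ → SATraceClass ℋ →L[ℝ] SATraceClass ℋ) : Prop :=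
  ∃ Tα : J → ℝ → SATraceClass ℋ →L[ℝ] SATraceClass ℋ,
    (∀ α, IsC0Semigroup (Tα α) ∧ IsGeneratorOf (-(subOnDomain H (Kα α))) (Tα α)) ∧
    ∀ t : ℝ, 0 < t → ∀ u : SATraceClass ℋ, Tendsto (fun α => Tα α t u) atTop (𝓝 (T t u))

end

end

/-! Minimality is a Duhamel comparison. For positive `u` in `D(H)` the curve `s ↦ T'_{t-s} T^α_s u`
runs from `T'_t u` to `T^α_t u`, and its right derivative is `T'_{t-s} (K_α - K) T^α_s u ≤ 0`,
because `-L'` acts as `-(H - K)` on `D(H)` and both semigroups preserve the cone. Hence `T^α_t u ≤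
T'_t u`. Averages of orbits give enough positive elements of `D(H)` to reach every `u ≥ 0`, and
since the cone is closed the inequality survives the limit in `α`
(`PositiveSemigroup.apply_le_apply`).

The comparison needs `T^α` to be positive, and the limit needs `T^α` to be contractive and
increasing in `α`. The decisive fact is that the trace norm is the trace, hence additive, on the
positive cone. Writing `R` for `(l + H)⁻¹`, the relative bound `b_α < 1` makes `K_α R` a strict
contraction for large `l`, so a Neumann series yields a positive resolvent of `-(H - K_α)`; its norm
is at most `1/l` because `Tr (K_α u) ≤ Tr (H u)`. The Hille–Yosida theorem then produces a dynamical
semigroup (`exists_perturbation`). The same Duhamel argument shows that these semigroups increase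
with `α`, and a bounded increasing net converges because the distance of comparable elements is a
difference of traces (`exists_tendsto_of_monotone`). -/

noncomputable section

open TraceClass

/-! ### The positive cone, the trace and completeness of the trace norm -/

namespace SATraceClass

variable {ℋ : Type*} [NormedAddCommGroup ℋ] [InnerProductSpace ℂ ℋ] [CompleteSpace ℋ]

/-- The quadratic form `u ↦ re ⟪x, u x⟫` at a fixed vector, as a linear functional of `u`. -/
def quad (x : ℋ) : SATraceClass ℋ →ₗ[ℝ] ℝ where
  toFun u := (⟪x, toOp u x⟫_ℂ).re
  map_add' u v := by simp
  map_smul' r u := by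
    rw [map_smul, smul_apply, inner_smul_right_eq_smul]
    simp

lemma quad_apply (x : ℋ) (u : SATraceClass ℋ) : quad x u = (⟪x, toOp u x⟫_ℂ).re := rfl

lemma nonneg_iff_toOp {u : SATraceClass ℋ} : 0 ≤ u ↔ 0 ≤ toOp u := by
  change toOp (0 : SATraceClass ℋ) ≤ toOp u ↔ _
  rw [map_zero]

lemma nonneg_iff_quad {u : SATraceClass ℋ} : 0 ≤ u ↔ ∀ x, 0 ≤ quad x u := by
  constructor
  · intro h x
    exact diag_nonneg (nonneg_iff_toOp.1 h) x
  · intro h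
    rw [nonneg_iff_toOp, ContinuousLinearMap.nonneg_iff_isPositive]
    refine (ContinuousLinearMap.isPositive_def' ).2 ⟨isSelfAdjoint_toOp u, fun x => ?_⟩
    rw [ContinuousLinearMap.reApplyInnerSelf_apply, ← inner_re_symm]
    exact h x

instance : IsOrderedAddMonoid (SATraceClass ℋ) where
  add_le_add_left u v h w := by
    change toOp (u + w) ≤ toOp (v + w)
    rw [map_add, map_add]
    exact add_le_add h le_rfl

lemma smul_nonneg' {r : ℝ} (hr : 0 ≤ r) {u : SATraceClass ℋ} (hu : 0 ≤ u) : 0 ≤ r • u := by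
  rw [nonneg_iff_quad] at *
  intro x
  rw [map_smul]
  exact mul_nonneg hr (hu x)

lemma ofReal_norm (u : SATraceClass ℋ) : ENNReal.ofReal ‖u‖ = traceNorm (toOp u) :=
  ENNReal.ofReal_toReal (traceNorm_toOp_ne_top u)

/-- With `s = |u|^{1/2}`, Parseval and Cauchy–Schwarz give `‖s x‖² = ∑ |⟪s bᵢ, x⟫|² ≤ (∑ ‖s bᵢ‖²)
‖x‖²`, and the last sum is `Tr |u|`. The operator norm of `u` is `‖s‖²`. -/
lemma norm_toOp_le (u : SATraceClass ℋ) : ‖toOp u‖ ≤ ‖u‖ := by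
  set a := CFC.abs (toOp u) with ha
  have ha0 : 0 ≤ a := CFC.abs_nonneg _
  set s := CFC.sqrt a with hs
  have hsym : s.IsPositive :=
    (ContinuousLinearMap.nonneg_iff_isPositive _).1 (CFC.sqrt_nonneg a)
  have h1 : ‖s‖ ≤ √‖u‖ := by
    refine ContinuousLinearMap.opNorm_le_bound _ (Real.sqrt_nonneg _) fun x => ?_
    rw [← Real.sqrt_sq (norm_nonneg x), ← Real.sqrt_mul (norm_nonneg u)]
    refine Real.le_sqrt_of_sq_le ?_
    rw [← ENNReal.ofReal_le_ofReal_iff (by positivity), ENNReal.ofReal_mul (norm_nonneg _),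
      ofReal_norm, ofReal_norm_sq_eq_tsum (stdBasis ℋ)]
    unfold traceNorm diagSum
    rw [← ENNReal.tsum_mul_right]
    refine ENNReal.tsum_le_tsum fun i => ?_
    have h0 := diag_nonneg ha0 (stdBasis ℋ i)
    rw [← ENNReal.ofReal_mul h0]
    refine ENNReal.ofReal_le_ofReal ?_
    rw [inner_eq_norm_sqrt ha0, ← hsym.inner_left_eq_inner_right, ← mul_pow]
    gcongr
    exact norm_inner_le_norm _ _
  have h2 : ‖toOp u‖ = ‖s‖ ^ 2 := by
    rw [hs, CFC.norm_sqrt a ha0, Real.sq_sqrt (norm_nonneg _), ha, CFC.norm_abs]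
  rw [h2]
  calc ‖s‖ ^ 2 ≤ √‖u‖ ^ 2 := by gcongr
    _ = ‖u‖ := Real.sq_sqrt (norm_nonneg _)

lemma abs_quad_le (x : ℋ) (u : SATraceClass ℋ) : |quad x u| ≤ ‖x‖ ^ 2 * ‖u‖ := by
  rw [quad_apply]
  calc |(⟪x, toOp u x⟫_ℂ).re| ≤ ‖⟪x, toOp u x⟫_ℂ‖ := Complex.abs_re_le_norm _
    _ ≤ ‖x‖ * ‖toOp u x‖ := norm_inner_le_norm _ _
    _ ≤ ‖x‖ * (‖u‖ * ‖x‖) := by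
        gcongr
        exact (toOp u).le_of_opNorm_le (norm_toOp_le u) x
    _ = ‖x‖ ^ 2 * ‖u‖ := by ring

/-- The quadratic form at `x` as a bounded functional. -/
def quadCLM (x : ℋ) : SATraceClass ℋ →L[ℝ] ℝ := (quad x).mkContinuous _ (abs_quad_le x)

lemma quadCLM_apply (x : ℋ) (u : SATraceClass ℋ) : quadCLM x u = quad x u := rfl

lemma isClosed_nonneg : IsClosed {u : SATraceClass ℋ | 0 ≤ u} := by
  have : {u : SATraceClass ℋ | 0 ≤ u} = ⋂ x, {u | 0 ≤ quadCLM x u} := by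
    ext u
    simp [nonneg_iff_quad, quadCLM_apply]
  rw [this]
  exact isClosed_iInter fun x => isClosed_le continuous_const (quadCLM x).continuous

lemma sum_abs_quad_le {ι : Type*} (b : HilbertBasis ι ℂ ℋ) (s : Finset ι) (u : SATraceClass ℋ) :
    ∑ i ∈ s, |quad (b i) u| ≤ ‖u‖ := by
  rw [← ENNReal.ofReal_le_ofReal_iff (norm_nonneg _), ofReal_norm, traceNorm_eq b,
    ENNReal.ofReal_sum_of_nonneg fun i _ => abs_nonneg _]
  refine (Finset.sum_le_sum fun i _ => ENNReal.ofReal_le_ofReal ?_).trans (ENNReal.sum_le_tsum s)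
  exact abs_diag_le (isSelfAdjoint_toOp u) _

/-- A basis adapted to `w⁺` and `w⁻` turns `|⟪bᵢ, w bᵢ⟫| ≤ ⟪bᵢ, |w| bᵢ⟫` into an equality. Together
with `sum_abs_quad_le` this makes the trace norm a supremum of finite diagonal sums, each continuous
in the operator norm. -/
lemma exists_basis_traceNorm_eq {w : ℋ →L[ℂ] ℋ} (hw : IsSelfAdjoint w) :
    ∃ (ι : Set ℋ) (b : HilbertBasis ι ℂ ℋ),
      traceNorm w = ∑' i, ENNReal.ofReal |(⟪b i, w (b i)⟫_ℂ).re| := by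
  obtain ⟨ι, b, hb⟩ := exists_adapted_basis w
  refine ⟨ι, b, ?_⟩
  rw [traceNorm_eq b]
  refine tsum_congr fun i => ?_
  have e1 : w (b i) = w⁺ (b i) - w⁻ (b i) := by
    conv_lhs => rw [← CFC.posPart_sub_negPart w hw]
    rfl
  have e2 : CFC.abs w (b i) = w⁺ (b i) + w⁻ (b i) := by
    rw [← CFC.posPart_add_negPart w hw]
    rfl
  have h1 := diag_nonneg (CFC.posPart_nonneg w) (b i)
  have h2 := diag_nonneg (CFC.negPart_nonneg w) (b i)
  rw [e1, e2]
  rcases hb i with h | h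
  · rw [h, add_zero, sub_zero, abs_of_nonneg h1]
  · rw [h, zero_add, zero_sub, inner_neg_right, Complex.neg_re, abs_neg, abs_of_nonneg h2]

/-- Lower semicontinuity of the trace norm with respect to the operator norm. -/
lemma traceNorm_le_of_tendsto {w : ℋ →L[ℂ] ℋ} (hw : IsSelfAdjoint w) {v : ℕ → SATraceClass ℋ}
    (hv : Tendsto (fun n => toOp (v n)) atTop (𝓝 w)) {C : ℝ} (hC : ∀ᶠ n in atTop, ‖v n‖ ≤ C) :
    traceNorm w ≤ ENNReal.ofReal C := by
  obtain ⟨ι, b, hb⟩ := exists_basis_traceNorm_eq hw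
  rw [hb]
  refine ENNReal.summable.tsum_le_of_sum_le fun s => ?_
  rw [← ENNReal.ofReal_sum_of_nonneg fun i _ => abs_nonneg _]
  refine ENNReal.ofReal_le_ofReal ?_
  have : Tendsto (fun n => ∑ i ∈ s, |quad (b i) (v n)|) atTop
      (𝓝 (∑ i ∈ s, |(⟪b i, w (b i)⟫_ℂ).re|)) := by
    refine tendsto_finsetSum _ fun i _ => ?_
    have h1 : Continuous fun a : ℋ →L[ℂ] ℋ => |(⟪b i, a (b i)⟫_ℂ).re| := by fun_prop
    exact (h1.tendsto w).comp hv
  refine le_of_tendsto this (hC.mono fun n hn => ?_)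
  exact (sum_abs_quad_le b s (v n)).trans hn

instance : CompleteSpace (SATraceClass ℋ) := by
  refine Metric.complete_of_cauchySeq_tendsto fun u hu => ?_
  have hc : CauchySeq fun n => toOp (u n) := by
    rw [Metric.cauchySeq_iff] at hu ⊢
    intro ε hε
    obtain ⟨N, hN⟩ := hu ε hε
    refine ⟨N, fun m hm n hn => ?_⟩
    have := hN m hm n hn
    rw [dist_eq_norm] at this ⊢
    rw [← map_sub]
    exact (norm_toOp_le _).trans_lt this
  obtain ⟨w, hw⟩ := cauchySeq_tendsto_of_complete hc
  have hsa : IsSelfAdjoint w :=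
    tendsto_nhds_unique ((continuous_star.tendsto w).comp hw)
      (hw.congr fun n => (isSelfAdjoint_toOp (u n)).star_eq.symm)
  obtain ⟨C, hC⟩ := hu.norm_bddAbove
  have hfin : traceNorm w ≠ ∞ := ne_top_of_le_ne_top ENNReal.ofReal_ne_top
    (traceNorm_le_of_tendsto hsa hw (C := C) (Eventually.of_forall fun n => hC ⟨n, rfl⟩))
  let a : SATraceClass ℋ := ⟨w, hsa, hfin⟩
  have ha : toOp a = w := rfl
  refine ⟨a, Metric.tendsto_atTop'.2 fun ε hε => ?_⟩
  obtain ⟨N, hN⟩ := Metric.cauchySeq_iff.1 hu (ε / 2) (by positivity)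
  refine ⟨N, fun n hn => ?_⟩
  -- Convergence in trace norm: for fixed `n`, the operator-norm limit in `m` of `u n - u m` is `u n
  -- - a`, and lower semicontinuity preserves the Cauchy bound `ε / 2`.
  have h1 : Tendsto (fun m => toOp (u n - u m)) atTop (𝓝 (toOp (u n - a))) := by
    simp_rw [map_sub, ha]
    exact hw.const_sub _
  have h2 := traceNorm_le_of_tendsto (isSelfAdjoint_toOp _) h1 (C := ε / 2)
    ((eventually_ge_atTop N).mono fun m hm => by
      rw [← dist_eq_norm]; exact (hN n hn.le m hm).le)
  rw [← ofReal_norm, ENNReal.ofReal_le_ofReal_iff (by positivity)] at h2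
  rw [dist_eq_norm]
  linarith

lemma summable_quad (u : SATraceClass ℋ) : Summable fun i => quad (stdBasis ℋ i) u :=
  .of_abs <| summable_of_sum_le (fun _ => abs_nonneg _) fun s => sum_abs_quad_le _ s u

lemma tr_eq (u : SATraceClass ℋ) : tr u = ∑' i, quad (stdBasis ℋ i) u := rfl

lemma tr_add (u v : SATraceClass ℋ) : tr (u + v) = tr u + tr v := by
  simp_rw [tr_eq, map_add]
  exact (summable_quad u).tsum_add (summable_quad v)

lemma tr_smul (r : ℝ) (u : SATraceClass ℋ) : tr (r • u) = r * tr u := by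
  simp_rw [tr_eq, map_smul, smul_eq_mul]
  exact tsum_mul_left

lemma tr_sub (u v : SATraceClass ℋ) : tr (u - v) = tr u - tr v := by
  rw [sub_eq_add_neg, tr_add, ← neg_one_smul ℝ v, tr_smul]
  ring

lemma tr_nonneg {u : SATraceClass ℋ} (hu : 0 ≤ u) : 0 ≤ tr u :=
  tsum_nonneg fun _ => nonneg_iff_quad.1 hu _

lemma tr_mono {u v : SATraceClass ℋ} (h : u ≤ v) : tr u ≤ tr v := by
  have := tr_nonneg (sub_nonneg.2 h)
  rw [tr_sub] at this
  linarith

lemma norm_of_nonneg {u : SATraceClass ℋ} (hu : 0 ≤ u) : ‖u‖ = tr u := by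
  rw [norm_def, traceNorm, diagSum, CFC.abs_of_nonneg _ (nonneg_iff_toOp.1 hu), tr_eq,
    ← ENNReal.toReal_ofReal (tsum_nonneg fun i => nonneg_iff_quad.1 hu (stdBasis ℋ i)),
    ENNReal.ofReal_tsum_of_nonneg (fun i => nonneg_iff_quad.1 hu _) (summable_quad u)]
  rfl

/-- The Jordan decomposition. -/
lemma exists_sub_eq (u : SATraceClass ℋ) :
    ∃ p q : SATraceClass ℋ, 0 ≤ p ∧ 0 ≤ q ∧ p - q = u ∧ ‖p‖ + ‖q‖ = ‖u‖ := by
  have hu := isSelfAdjoint_toOp u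
  have hsum : traceNorm (toOp u) = traceNorm (toOp u)⁺ + traceNorm (toOp u)⁻ := by
    unfold traceNorm diagSum
    rw [← ENNReal.tsum_add]
    refine tsum_congr fun i => ?_
    have h1 := CFC.posPart_nonneg (toOp u)
    have h2 := CFC.negPart_nonneg (toOp u)
    rw [CFC.abs_of_nonneg _ h1, CFC.abs_of_nonneg _ h2,
      ← ENNReal.ofReal_add (diag_nonneg h1 _) (diag_nonneg h2 _),
      ← CFC.posPart_add_negPart (toOp u) hu]
    congr 1
    rw [add_apply, inner_add_right, Complex.add_re]
  have hfin := traceNorm_toOp_ne_top u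
  rw [hsum, ENNReal.add_ne_top] at hfin
  refine ⟨⟨(toOp u)⁺, IsSelfAdjoint.of_nonneg (CFC.posPart_nonneg _), hfin.1⟩,
    ⟨(toOp u)⁻, IsSelfAdjoint.of_nonneg (CFC.negPart_nonneg _), hfin.2⟩, ?_, ?_, ?_, ?_⟩
  · exact nonneg_iff_toOp.2 (CFC.posPart_nonneg (toOp u))
  · exact nonneg_iff_toOp.2 (CFC.negPart_nonneg (toOp u))
  · exact toOp_injective (CFC.posPart_sub_negPart (toOp u) hu)
  · rw [norm_def u, hsum, ENNReal.toReal_add hfin.1 hfin.2]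
    rfl

/-- The Jordan decomposition splits the norm additively, so a trace bound on the cone is already a
norm bound on the whole space. -/
lemma norm_map_le_of_tr_le {B : SATraceClass ℋ →ₗ[ℝ] SATraceClass ℋ}
    (hB : ∀ u, 0 ≤ u → 0 ≤ B u) {c : ℝ} (hc : ∀ u, 0 ≤ u → tr (B u) ≤ c * tr u)
    (u : SATraceClass ℋ) : ‖B u‖ ≤ c * ‖u‖ := by
  obtain ⟨p, q, hp, hq, rfl, h⟩ := exists_sub_eq u
  rw [map_sub, ← h, mul_add]
  refine (norm_sub_le _ _).trans (add_le_add ?_ ?_)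
  · rw [norm_of_nonneg (hB p hp), norm_of_nonneg hp]; exact hc p hp
  · rw [norm_of_nonneg (hB q hq), norm_of_nonneg hq]; exact hc q hq

lemma norm_sub_of_le {u v : SATraceClass ℋ} (h : u ≤ v) : ‖v - u‖ = tr v - tr u := by
  rw [norm_of_nonneg (sub_nonneg.2 h), tr_sub]

/-- An increasing net with bounded trace converges in trace norm. -/
lemma exists_tendsto_of_monotone {J : Type*} [Preorder J] [IsDirectedOrder J] [Nonempty J]
    {f : J → SATraceClass ℋ} (hf : Monotone f) {C : ℝ} (hC : ∀ j, tr (f j) ≤ C) :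
    ∃ u, Tendsto f atTop (𝓝 u) := by
  have ht : Tendsto (fun j => tr (f j)) atTop (𝓝 (⨆ j, tr (f j))) :=
    tendsto_atTop_ciSup (fun i j hij => tr_mono (hf hij)) ⟨C, by rintro _ ⟨j, rfl⟩; exact hC j⟩
  have hc : Cauchy (map f atTop) := by
    refine Metric.cauchy_iff.2 ⟨inferInstance, fun ε hε => ?_⟩
    obtain ⟨N, hN⟩ := eventually_atTop.1 (Metric.tendsto_nhds.1 ht (ε / 4) (by positivity))
    -- For `n ≥ N` the distance is `tr (f n) - tr (f N)`, so convergence of the increasing, bounded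
    -- traces forces the net itself to be Cauchy.
    have key : ∀ n ≥ N, dist (f n) (f N) < ε / 2 := by
      intro n hn
      rw [dist_eq_norm, norm_sub_of_le (hf hn)]
      have h1 := abs_lt.1 (hN n hn)
      have h2 := abs_lt.1 (hN N le_rfl)
      linarith
    refine ⟨f '' Set.Ici N, image_mem_map (mem_atTop N), ?_⟩
    rintro _ ⟨n, hn, rfl⟩ _ ⟨m, hm, rfl⟩
    have := dist_triangle_right (f n) (f m) (f N)
    linarith [key n hn, key m hm]
  exact CompleteSpace.complete hc

end SATraceClass

/-! ### `C₀`-semigroups and their generators -/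

section C0Semigroup

variable {X : Type*} [NormedAddCommGroup X] [NormedSpace ℝ X]

/-- The extension of a family `(T t)_{t > 0}` by the identity to all of `ℝ`. -/
def extendOne (T : ℝ → X →L[ℝ] X) (t : ℝ) : X →L[ℝ] X := if 0 < t then T t else 1

lemma extendOne_of_pos (T : ℝ → X →L[ℝ] X) {t : ℝ} (ht : 0 < t) : extendOne T t = T t := if_pos ht

lemma extendOne_of_nonpos (T : ℝ → X →L[ℝ] X) {t : ℝ} (ht : t ≤ 0) : extendOne T t = 1 :=
  if_neg ht.not_gt

@[simp] lemma extendOne_zero (T : ℝ → X →L[ℝ] X) : extendOne T 0 = 1 :=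
  extendOne_of_nonpos T le_rfl

/-- `u` lies in the domain of the infinitesimal generator of `T`, and is mapped to `v`. -/
def GeneratesAt (T : ℝ → X →L[ℝ] X) (u v : X) : Prop :=
  Tendsto (fun t : ℝ => t⁻¹ • (T t u - u)) (𝓝[>] 0) (𝓝 v)

lemma GeneratesAt.unique {T : ℝ → X →L[ℝ] X} {u v w : X} (hv : GeneratesAt T u v)
    (hw : GeneratesAt T u w) : v = w := tendsto_nhds_unique hv hw

lemma GeneratesAt.sub {T : ℝ → X →L[ℝ] X} {u v u' v' : X} (h : GeneratesAt T u v)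
    (h' : GeneratesAt T u' v') : GeneratesAt T (u - u') (v - v') := by
  refine (Tendsto.sub h h').congr fun t => ?_
  rw [map_sub, ← smul_sub]
  congr 1
  abel

lemma GeneratesAt.const_smul {T : ℝ → X →L[ℝ] X} {u v : X} (h : GeneratesAt T u v) (c : ℝ) :
    GeneratesAt T (c • u) (c • v) := by
  refine (Tendsto.const_smul h c).congr fun t => ?_
  rw [map_smul, ← smul_sub, smul_comm]

/-- Generators of contraction semigroups are dissipative. -/
lemma GeneratesAt.mul_norm_le {T : ℝ → X →L[ℝ] X} (hT : ∀ t, 0 < t → ‖T t‖ ≤ 1) {u v : X}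
    (h : GeneratesAt T u v) (l : ℝ) : l * ‖u‖ ≤ ‖l • u - v‖ := by
  refine ge_of_tendsto ((Tendsto.const_sub (l • u) h).norm) ?_
  filter_upwards [self_mem_nhdsWithin] with t (ht : 0 < t)
  have e : l • u - t⁻¹ • (T t u - u) = (l + t⁻¹) • u - t⁻¹ • T t u := by
    rw [smul_sub, add_smul]; abel
  have h1 : ‖T t u‖ ≤ 1 * ‖u‖ := (T t).le_of_opNorm_le (hT t ht) u
  have h2 : ‖t⁻¹ • T t u‖ ≤ t⁻¹ * ‖u‖ := by
    rw [norm_smul, Real.norm_of_nonneg (inv_nonneg.2 ht.le)]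
    gcongr
    simpa using h1
  have h3 : (l + t⁻¹) * ‖u‖ ≤ ‖(l + t⁻¹) • u‖ := by
    rw [norm_smul]
    gcongr
    exact le_abs_self _
  rw [e]
  have := norm_sub_norm_le ((l + t⁻¹) • u) (t⁻¹ • T t u)
  nlinarith

namespace IsC0Semigroup

variable {T : ℝ → X →L[ℝ] X}

lemma extendOne_add (hT : IsC0Semigroup T) {s t : ℝ} (hs : 0 ≤ s) (ht : 0 ≤ t) :
    extendOne T (s + t) = (extendOne T s).comp (extendOne T t) := by
  rcases hs.eq_or_lt with rfl | hs
  · simp [ContinuousLinearMap.one_def]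
  rcases ht.eq_or_lt with rfl | ht
  · simp [ContinuousLinearMap.one_def]
  rw [extendOne_of_pos T hs, extendOne_of_pos T ht, extendOne_of_pos T (add_pos hs ht),
    hT.add s t hs ht]

lemma extendOne_comm (hT : IsC0Semigroup T) {s t : ℝ} (hs : 0 ≤ s) (ht : 0 ≤ t) (u : X) :
    extendOne T s (extendOne T t u) = extendOne T t (extendOne T s u) := by
  have h := hT.extendOne_add hs ht
  rw [add_comm, hT.extendOne_add ht hs] at h
  exact (DFunLike.congr_fun h u).symm

lemma tendsto_extendOne (hT : IsC0Semigroup T) (u : X) :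
    Tendsto (fun t => extendOne T t u) (𝓝 0) (𝓝 u) := by
  rw [← nhdsLE_sup_nhdsGT, tendsto_sup]
  constructor
  · refine tendsto_const_nhds.congr' ?_
    filter_upwards [self_mem_nhdsWithin] with t ht
    simp [extendOne_of_nonpos T ht]
  · refine (hT.tendsto_zero u).congr' ?_
    filter_upwards [self_mem_nhdsWithin] with t ht
    rw [extendOne_of_pos T ht]

/-- Otherwise some times `t n → 0` would have operators of norm above `n + 1`, although every orbit
along them converges; this contradicts the uniform boundedness principle. -/
lemma exists_norm_le_near_zero [CompleteSpace X] (hT : IsC0Semigroup T) :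
    ∃ δ > 0, ∃ M, 1 ≤ M ∧ ∀ t ∈ Set.Icc 0 δ, ‖extendOne T t‖ ≤ M := by
  by_contra! h
  have h' : ∀ n : ℕ, ∃ t ∈ Set.Icc (0 : ℝ) (1 / (n + 1)), (n + 1 : ℝ) < ‖extendOne T t‖ :=
    fun n => h _ (by positivity) (n + 1) (by linarith [n.cast_nonneg (α := ℝ)])
  choose t ht hn using h'
  have h0 : Tendsto t atTop (𝓝 0) :=
    squeeze_zero (fun n => (ht n).1) (fun n => (ht n).2) tendsto_one_div_add_atTop_nhds_zero_nat
  obtain ⟨C, hC⟩ := banach_steinhaus (g := fun n => extendOne T (t n)) fun u => by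
    obtain ⟨C, hC⟩ := ((hT.tendsto_extendOne u).comp h0).norm.bddAbove_range
    exact ⟨C, fun n => hC ⟨n, rfl⟩⟩
  obtain ⟨n, hn'⟩ := exists_nat_gt C
  linarith [hn n, hC n]

lemma exists_norm_le [CompleteSpace X] (hT : IsC0Semigroup T) (N : ℝ) :
    ∃ M, ∀ t ≤ N, ‖extendOne T t‖ ≤ M := by
  obtain ⟨δ, hδ, M, hM, h⟩ := hT.exists_norm_le_near_zero
  have key : ∀ n : ℕ, ∀ t ≤ n * δ, ‖extendOne T t‖ ≤ M ^ n := by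
    intro n
    induction n with
    | zero =>
      intro t ht
      rw [extendOne_of_nonpos T (by simpa using ht), pow_zero]
      exact ContinuousLinearMap.norm_id_le
    | succ n ih =>
      intro t ht
      push_cast at ht
      by_cases hn : t ≤ n * δ
      · exact (ih t hn).trans (pow_le_pow_right₀ hM n.le_succ)
      · push Not at hn
        have h0 : (0 : ℝ) ≤ n * δ := by positivity
        have e : t = n * δ + (t - n * δ) := by ring
        rw [e, hT.extendOne_add h0 (by linarith), pow_succ]
        refine (ContinuousLinearMap.opNorm_comp_le _ _).trans ?_
        gcongr
        · exact ih _ le_rfl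
        · exact h _ ⟨by linarith, by linarith⟩
  obtain ⟨n, hn⟩ := exists_nat_ge (N / δ)
  exact ⟨M ^ n, fun t ht => key n t (ht.trans ((div_le_iff₀ hδ).1 hn))⟩

lemma norm_extendOne_sub_le (hT : IsC0Semigroup T) {N M : ℝ} (hM : ∀ t ≤ N, ‖extendOne T t‖ ≤ M)
    (u : X) {s t : ℝ} (hs : 0 ≤ s) (hsN : s ≤ N) (ht : 0 ≤ t) (htN : t ≤ N) :
    ‖extendOne T s u - extendOne T t u‖ ≤ M * ‖extendOne T |s - t| u - u‖ := by
  wlog hst : t ≤ s generalizing s t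
  · rw [norm_sub_rev, abs_sub_comm]
    exact this ht htN hs hsN (le_of_not_ge hst)
  have h0 : 0 ≤ s - t := sub_nonneg.2 hst
  have e : s = t + (s - t) := by ring
  rw [abs_of_nonneg h0]
  conv_lhs => rw [e, hT.extendOne_add ht h0, ContinuousLinearMap.comp_apply, ← map_sub]
  exact (extendOne T t).le_of_opNorm_le (hM t htN) _

lemma continuous_extendOne [CompleteSpace X] (hT : IsC0Semigroup T) (u : X) :
    Continuous fun t => extendOne T t u := by
  have e : (fun t => extendOne T t u) = fun t => extendOne T (max t 0) u := by
    funext t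
    rcases le_total t 0 with h | h
    · rw [max_eq_right h, extendOne_of_nonpos T h, extendOne_zero]
    · rw [max_eq_left h]
  rw [e, continuous_iff_continuousAt]
  intro t
  obtain ⟨M, hM⟩ := hT.exists_norm_le (max t 0 + 1)
  have h1 : Tendsto (fun s => |max s 0 - max t 0|) (𝓝 t) (𝓝 0) := by
    have : Continuous fun s : ℝ => |max s 0 - max t 0| := by fun_prop
    simpa using this.tendsto t
  have h2 : Tendsto (fun s => M * ‖extendOne T |max s 0 - max t 0| u - u‖) (𝓝 t) (𝓝 0) := by
    simpa using ((((hT.tendsto_extendOne u).comp h1).sub_const u).norm.const_mul M)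
  refine tendsto_iff_norm_sub_tendsto_zero.2
    (squeeze_zero' (Eventually.of_forall fun _ => norm_nonneg _) ?_ h2)
  have h3 : ∀ᶠ s : ℝ in 𝓝 t, s < max t 0 + 1 :=
    (isOpen_Iio.mem_nhds (show t < max t 0 + 1 by linarith [le_max_left t 0]))
  filter_upwards [h3] with s hs
  have h4 : (0 : ℝ) ≤ max t 0 := le_max_right _ _
  exact hT.norm_extendOne_sub_le hM u (le_max_right _ _) (max_le hs.le (by linarith)) h4
    (by linarith)

/-- Joint continuity in time and vector follows from strong continuity and local uniform
boundedness. It is what allows products `T'(t - s) T(s)` to be differentiated. -/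
lemma tendsto_extendOne_apply [CompleteSpace X] (hT : IsC0Semigroup T) {ι : Type*} {l : Filter ι}
    {r : ι → ℝ} {y : ι → X} {r₀ : ℝ} {y₀ : X} (hr : Tendsto r l (𝓝 r₀)) (hy : Tendsto y l (𝓝 y₀)) :
    Tendsto (fun i => extendOne T (r i) (y i)) l (𝓝 (extendOne T r₀ y₀)) := by
  obtain ⟨M, hM⟩ := hT.exists_norm_le (r₀ + 1)
  have h1 : Tendsto (fun i => extendOne T (r i) y₀) l (𝓝 (extendOne T r₀ y₀)) :=
    ((hT.continuous_extendOne y₀).tendsto r₀).comp hr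
  have h2 : Tendsto (fun i => extendOne T (r i) (y i - y₀)) l (𝓝 0) := by
    have h3 : Tendsto (fun i => M * ‖y i - y₀‖) l (𝓝 0) := by
      simpa using (hy.sub_const y₀).norm.const_mul M
    refine squeeze_zero_norm' ?_ h3
    filter_upwards [hr.eventually_lt_const (lt_add_one r₀)] with i hi
    exact (extendOne T (r i)).le_of_opNorm_le (hM _ hi.le) _
  simpa using h2.add h1

lemma generatesAt_extendOne (hT : IsC0Semigroup T) {u v : X} (h : GeneratesAt T u v) {t : ℝ}
    (ht : 0 ≤ t) : GeneratesAt T (extendOne T t u) (extendOne T t v) := by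
  refine (((extendOne T t).continuous.tendsto v).comp h).congr' ?_
  filter_upwards [self_mem_nhdsWithin] with s (hs : 0 < s)
  have := hT.extendOne_comm ht hs.le u
  rw [extendOne_of_pos T hs] at this
  simp [this]

/-- The derivative of `s ↦ T'(t - s) T(s) u`, from the right. -/
lemma hasDerivWithinAt_comp [CompleteSpace X] {T' : ℝ → X →L[ℝ] X} (hT : IsC0Semigroup T)
    (hT' : IsC0Semigroup T') {u v w : X} {s t : ℝ} (hs : 0 ≤ s) (hst : s < t)
    (hv : GeneratesAt T (extendOne T s u) v) (hw : GeneratesAt T' (extendOne T s u) w) :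
    HasDerivWithinAt (fun s => extendOne T' (t - s) (extendOne T s u))
      (extendOne T' (t - s) (v - w)) (Set.Ici s) s := by
  rw [← hasDerivWithinAt_Ioi_iff_Ici, hasDerivWithinAt_iff_tendsto_slope' Set.self_notMem_Ioi]
  have h0 : Tendsto (fun y => y - s) (𝓝[>] s) (𝓝[>] 0) := by
    refine tendsto_nhdsWithin_iff.2 ⟨?_, ?_⟩
    · have : Tendsto (fun y => y - s) (𝓝 s) (𝓝 (s - s)) := by
        exact (continuous_id.sub continuous_const).tendsto s
      rw [sub_self] at this
      exact this.mono_left nhdsWithin_le_nhds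
    · filter_upwards [self_mem_nhdsWithin] with y (hy : s < y)
      exact sub_pos.2 hy
  have h1 : Tendsto (fun y => t - y) (𝓝[>] s) (𝓝 (t - s)) :=
    ((continuous_const.sub continuous_id).tendsto s).mono_left nhdsWithin_le_nhds
  -- For `y > s` the slope equals `T'(t - y)` applied to the difference of the two generator
  -- quotients at `T(s) u`. Only right derivatives are available, since the factorisation `T'(t - s)
  -- = T'(t - y) T'(y - s)` needs `y ≥ s`.
  refine (hT'.tendsto_extendOne_apply h1 ((hv.comp h0).sub (hw.comp h0))).congr' ?_
  have h2 : ∀ᶠ y in 𝓝[>] s, y < t := nhdsWithin_le_nhds (isOpen_Iio.mem_nhds hst)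
  filter_upwards [self_mem_nhdsWithin, h2] with y (hy : s < y) hyt
  have hys : 0 < y - s := sub_pos.2 hy
  have e1 : extendOne T y u = T (y - s) (extendOne T s u) := by
    rw [← extendOne_of_pos T hys, ← ContinuousLinearMap.comp_apply, ← hT.extendOne_add hys.le hs,
      sub_add_cancel]
  have e2 : extendOne T' (t - s) = (extendOne T' (t - y)).comp (T' (y - s)) := by
    rw [← extendOne_of_pos T' hys, ← hT'.extendOne_add (sub_nonneg.2 hyt.le) hys.le]
    congr 1
    ring
  simp only [Function.comp_apply]
  rw [slope_def_module, e1, e2, ContinuousLinearMap.comp_apply, ← map_sub, ← smul_sub, map_smul]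
  congr 2
  abel

lemma continuousOn_comp [CompleteSpace X] {T' : ℝ → X →L[ℝ] X} (hT : IsC0Semigroup T)
    (hT' : IsC0Semigroup T') (u : X) (t : ℝ) (A : Set ℝ) :
    ContinuousOn (fun s => extendOne T' (t - s) (extendOne T s u)) A := by
  refine Continuous.continuousOn (continuous_iff_continuousAt.2 fun s => ?_)
  exact hT'.tendsto_extendOne_apply ((continuous_const.sub continuous_id).tendsto s)
    ((hT.continuous_extendOne u).tendsto s)

lemma hasDerivAt_integral [CompleteSpace X] (hT : IsC0Semigroup T) (u : X) (t : ℝ) :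
    HasDerivAt (fun t => ∫ s in (0 : ℝ)..t, extendOne T s u) (extendOne T t u) t :=
  intervalIntegral.integral_hasDerivAt_right
    ((hT.continuous_extendOne u).intervalIntegrable _ _)
    (hT.continuous_extendOne u).aestronglyMeasurable.stronglyMeasurableAtFilter
    (hT.continuous_extendOne u).continuousAt

/-- `T h` shifts the interval of integration from `[0, t]` to `[h, t + h]`. The difference of the
two integrals is an integral near `t` minus one near `0`, and both are differentiated by the
fundamental theorem of calculus. -/
lemma generatesAt_integral [CompleteSpace X] (hT : IsC0Semigroup T) (u : X) {t : ℝ} (ht : 0 ≤ t) :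
    GeneratesAt T (∫ s in (0 : ℝ)..t, extendOne T s u) (extendOne T t u - u) := by
  have hi : ∀ a b, IntervalIntegrable (fun s => extendOne T s u) MeasureTheory.volume a b :=
    fun a b => (hT.continuous_extendOne u).intervalIntegrable a b
  have h1 := (hT.hasDerivAt_integral u t).tendsto_slope_zero_right
  have h2 := (hT.hasDerivAt_integral u 0).tendsto_slope_zero_right
  have h3 := h1.sub h2
  rw [extendOne_zero, one_apply_eq_self] at h3
  refine h3.congr' ?_
  filter_upwards [self_mem_nhdsWithin] with h (hh : 0 < h)
  rw [← smul_sub, intervalIntegral.integral_same, sub_zero, zero_add]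
  congr 1
  have e1 : T h (∫ s in (0 : ℝ)..t, extendOne T s u) = ∫ s in h..(t + h), extendOne T s u := by
    rw [← ContinuousLinearMap.intervalIntegral_comp_comm _ (hi 0 t)]
    have : ∫ s in (0 : ℝ)..t, T h (extendOne T s u) =
        ∫ s in (0 : ℝ)..t, extendOne T (s + h) u := by
      refine intervalIntegral.integral_congr fun s hs => ?_
      rw [Set.uIcc_of_le ht] at hs
      rw [add_comm, hT.extendOne_add hh.le hs.1, extendOne_of_pos T hh,
        ContinuousLinearMap.comp_apply]
    rw [this, intervalIntegral.integral_comp_add_right (fun s => extendOne T s u), zero_add]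
  rw [e1, ← intervalIntegral.integral_add_adjacent_intervals (hi 0 h) (hi h (t + h))]
  abel

/-- Averages of the orbit. -/
lemma tendsto_average [CompleteSpace X] (hT : IsC0Semigroup T) (u : X) :
    Tendsto (fun t : ℝ => t⁻¹ • ∫ s in (0 : ℝ)..t, extendOne T s u) (𝓝[>] 0) (𝓝 u) := by
  simpa using (hT.hasDerivAt_integral u 0).tendsto_slope_zero_right

lemma dense_generatesAt [CompleteSpace X] (hT : IsC0Semigroup T) :
    Dense {u | ∃ v, GeneratesAt T u v} := by
  intro u
  refine mem_closure_of_tendsto (hT.tendsto_average u) ?_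
  filter_upwards [self_mem_nhdsWithin] with t (ht : 0 < t)
  exact ⟨_, (hT.generatesAt_integral u ht.le).const_smul _⟩

/-- A `C₀`-semigroup is determined by its generator. -/
lemma eq_of_generatesAt [CompleteSpace X] {T' : ℝ → X →L[ℝ] X} (hT : IsC0Semigroup T)
    (hT' : IsC0Semigroup T') (h : ∀ u v, GeneratesAt T u v → GeneratesAt T' u v) {t : ℝ}
    (ht : 0 < t) : T t = T' t := by
  refine ContinuousLinearMap.ext fun u => ?_
  have hc : IsClosed {u | T t u = T' t u} := isClosed_eq (T t).continuous (T' t).continuous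
  refine hc.closure_subset_iff.2 ?_ (hT.dense_generatesAt u)
  rintro u ⟨v, hv⟩
  -- On the domain, `s ↦ T'(t - s) T(s) u` has vanishing right derivative, so its values at `0` and
  -- `t` agree.
  have key := constant_of_has_deriv_right_zero (hT.continuousOn_comp hT' u t (Set.Icc 0 t))
    (fun s hs => by
      have h1 := hT.generatesAt_extendOne hv hs.1
      simpa using hT.hasDerivWithinAt_comp hT' hs.1 hs.2 h1 (h _ _ h1)) t ⟨ht.le, le_rfl⟩
  simpa [extendOne_of_pos _ ht] using key

/-- Exponential rescaling. -/
lemma exp_smul (hT : IsC0Semigroup T) (l : ℝ) :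
    IsC0Semigroup fun t => Real.exp (-(l * t)) • T t where
  add s t hs ht := by
    ext u
    simp only [hT.add s t hs ht, smul_apply, ContinuousLinearMap.comp_apply,
      map_smul, smul_smul, ← Real.exp_add]
    congr 2
    ring
  tendsto_zero u := by
    have h1 : Tendsto (fun t : ℝ => Real.exp (-(l * t))) (𝓝[>] 0) (𝓝 1) := by
      have : Continuous fun t : ℝ => Real.exp (-(l * t)) := by fun_prop
      simpa using (this.tendsto 0).mono_left nhdsWithin_le_nhds
    simpa using h1.smul (hT.tendsto_zero u)

lemma generatesAt_of_exp_smul (hT : IsC0Semigroup T) {l : ℝ} {u v : X}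
    (h : GeneratesAt (fun t => Real.exp (-(l * t)) • T t) u v) : GeneratesAt T u (v + l • u) := by
  have h1 : Tendsto (fun t : ℝ => t⁻¹ • (1 - Real.exp (-(l * t)))) (𝓝[>] 0) (𝓝 l) := by
    have : HasDerivAt (fun t : ℝ => 1 - Real.exp (-(l * t))) l 0 := by
      have h2 := ((hasDerivAt_id (0 : ℝ)).const_mul l).neg.exp.const_sub 1
      simpa using h2
    simpa using this.tendsto_slope_zero_right
  refine (Tendsto.add h (h1.smul (hT.tendsto_zero u))).congr fun t => ?_
  rw [smul_assoc, ← smul_add]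
  congr 1
  simp only [smul_apply, sub_smul, one_smul]
  abel

end IsC0Semigroup

end C0Semigroup

/-! ### Strong limits of contractions -/

section Contractions

variable {X : Type*} [NormedAddCommGroup X] [NormedSpace ℝ X] {ι : Type*} {l : Filter ι}

lemma norm_apply_le_of_le_one {L : X →L[ℝ] X} (hL : ‖L‖ ≤ 1) (u : X) : ‖L u‖ ≤ ‖u‖ := by
  simpa using L.le_of_opNorm_le hL u

lemma tendsto_apply_of_norm_le_one {L : ι → X →L[ℝ] X} (hL : ∀ᶠ i in l, ‖L i‖ ≤ 1) {x : ι → X}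
    {x₀ y : X} (hx : Tendsto x l (𝓝 x₀)) (h : Tendsto (fun i => L i x₀) l (𝓝 y)) :
    Tendsto (fun i => L i (x i)) l (𝓝 y) := by
  have h2 : Tendsto (fun i => L i (x i - x₀)) l (𝓝 0) := by
    have h3 : Tendsto (fun i => ‖x i - x₀‖) l (𝓝 0) := by
      simpa using (hx.sub_const x₀).norm
    refine squeeze_zero_norm' ?_ h3
    filter_upwards [hL] with i hi
    exact norm_apply_le_of_le_one hi _
  simpa using h2.add h

lemma tendsto_self_of_dense {L : ι → X →L[ℝ] X} (hL : ∀ᶠ i in l, ‖L i‖ ≤ 1) {D : Set X}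
    (hD : Dense D) (h : ∀ u ∈ D, Tendsto (fun i => L i u) l (𝓝 u)) (u : X) :
    Tendsto (fun i => L i u) l (𝓝 u) := by
  refine Metric.tendsto_nhds.2 fun ε hε => ?_
  obtain ⟨p, hpD, hp⟩ := hD.exists_dist_lt u (ε := ε / 3) (by positivity)
  filter_upwards [hL, Metric.tendsto_nhds.1 (h p hpD) (ε / 3) (by positivity)] with i hi hi'
  have h1 : dist (L i u) (L i p) ≤ dist u p := by
    rw [dist_eq_norm, dist_eq_norm, ← map_sub]
    exact norm_apply_le_of_le_one hi _
  have h2 := dist_triangle4 (L i u) (L i p) p u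
  rw [dist_comm p u] at h2
  linarith

lemma cauchySeq_of_dense {L : ℕ → X →L[ℝ] X} (hL : ∀ n, ‖L n‖ ≤ 1) {D : Set X}
    (hD : Dense D) (h : ∀ u ∈ D, CauchySeq fun n => L n u) (u : X) :
    CauchySeq fun n => L n u := by
  refine Metric.cauchySeq_iff.2 fun ε hε => ?_
  obtain ⟨p, hpD, hp⟩ := hD.exists_dist_lt u (ε := ε / 3) (by positivity)
  obtain ⟨N, hN⟩ := Metric.cauchySeq_iff.1 (h p hpD) (ε / 3) (by positivity)
  refine ⟨N, fun m hm n hn => ?_⟩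
  have h1 : ∀ i, dist (L i u) (L i p) ≤ dist u p := fun i => by
    rw [dist_eq_norm, dist_eq_norm, ← map_sub]
    exact norm_apply_le_of_le_one (hL i) _
  have h2 := dist_triangle4 (L m u) (L m p) (L n p) (L n u)
  rw [dist_comm (L n p)] at h2
  linarith [h1 m, h1 n, hN m hm n hn]

lemma exists_limit_of_norm_le_one [l.NeBot] {L : ι → X →L[ℝ] X} (hL : ∀ i, ‖L i‖ ≤ 1)
    (h : ∀ u, ∃ v, Tendsto (fun i => L i u) l (𝓝 v)) :
    ∃ M : X →L[ℝ] X, ‖M‖ ≤ 1 ∧ ∀ u, Tendsto (fun i => L i u) l (𝓝 (M u)) := by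
  choose f hf using h
  let M₀ : X →ₗ[ℝ] X :=
    { toFun := f
      map_add' := fun u v => tendsto_nhds_unique (hf (u + v))
        (((hf u).add (hf v)).congr fun i => (map_add _ _ _).symm)
      map_smul' := fun c u => tendsto_nhds_unique (hf (c • u))
        (((hf u).const_smul c).congr fun i => (map_smul (L i) c u).symm) }
  have hM : ∀ u, ‖M₀ u‖ ≤ 1 * ‖u‖ := fun u => by
    rw [one_mul]
    exact le_of_tendsto (hf u).norm (Eventually.of_forall fun i =>
      norm_apply_le_of_le_one (hL i) u)
  exact ⟨M₀.mkContinuous 1 hM, M₀.mkContinuous_norm_le zero_le_one hM, hf⟩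

end Contractions

/-! ### Yosida approximation and the Hille–Yosida theorem -/

section HilleYosida

variable {X : Type*} [NormedAddCommGroup X] [NormedSpace ℝ X]

lemma norm_exp_le_exp_norm [CompleteSpace X] (B : X →L[ℝ] X) :
    ‖NormedSpace.exp B‖ ≤ Real.exp ‖B‖ := by
  have h1 := NormedSpace.exp_series_hasSum_exp' (𝕂 := ℝ) B
  have h2 := NormedSpace.exp_series_hasSum_exp' (𝕂 := ℝ) ‖B‖
  rw [← Real.exp_eq_exp_ℝ] at h2
  refine h1.norm_le_of_bounded h2 fun n => ?_
  rw [norm_smul, smul_eq_mul, Real.norm_of_nonneg (by positivity)]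
  gcongr
  rcases n.eq_zero_or_pos with rfl | hn
  · rw [pow_zero, pow_zero]
    exact ContinuousLinearMap.norm_id_le
  · exact norm_pow_le' B hn

/-- The exponential of the Yosida approximation `l² R - l`. -/
def yosidaExp (R : X →L[ℝ] X) (l t : ℝ) : X →L[ℝ] X :=
  Real.exp (-(l * t)) • NormedSpace.exp (t • (l ^ 2 • R))

lemma yosidaExp_zero (R : X →L[ℝ] X) (l : ℝ) : yosidaExp R l 0 = 1 := by
  simp [yosidaExp]

lemma norm_yosidaExp_le [CompleteSpace X] {R : X →L[ℝ] X} {l t : ℝ} (hl : 0 < l)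
    (hR : ‖R‖ ≤ l⁻¹) (ht : 0 ≤ t) : ‖yosidaExp R l t‖ ≤ 1 := by
  rw [yosidaExp, norm_smul, Real.norm_of_nonneg (Real.exp_pos _).le, Real.exp_neg,
    inv_mul_le_iff₀ (Real.exp_pos _), mul_one]
  refine (norm_exp_le_exp_norm _).trans (Real.exp_le_exp.2 ?_)
  rw [norm_smul, norm_smul, Real.norm_of_nonneg ht, Real.norm_of_nonneg (by positivity)]
  calc t * (l ^ 2 * ‖R‖) ≤ t * (l ^ 2 * l⁻¹) := by gcongr
    _ = l * t := by field_simp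

lemma hasDerivAt_yosidaExp [CompleteSpace X] (R : X →L[ℝ] X) (l t : ℝ) :
    HasDerivAt (yosidaExp R l) (yosidaExp R l t * (l ^ 2 • R - l • 1)) t := by
  have h1 : HasDerivAt (fun t : ℝ => Real.exp (-(l * t))) (-(l * Real.exp (-(l * t)))) t := by
    have := ((hasDerivAt_id t).const_mul l).neg.exp
    simpa [mul_comm] using this
  have h2 : HasDerivAt (yosidaExp R l) _ t :=
    h1.smul (hasDerivAt_exp_smul_const (𝕂 := ℝ) (l ^ 2 • R) t)
  refine h2.congr_deriv ?_
  symm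
  rw [yosidaExp, mul_sub, smul_mul_assoc, mul_smul_comm l, mul_one, smul_smul l (Real.exp _), neg_smul,
    ← sub_eq_add_neg]

lemma yosidaExp_add [CompleteSpace X] (R : X →L[ℝ] X) (l s t : ℝ) :
    yosidaExp R l (s + t) = yosidaExp R l s * yosidaExp R l t := by
  let _ : NormedAlgebra ℚ (X →L[ℝ] X) := NormedAlgebra.restrictScalars ℚ ℝ (X →L[ℝ] X)
  have hc : Commute (s • (l ^ 2 • R)) (t • (l ^ 2 • R)) :=
    ((Commute.refl _).smul_left s).smul_right t
  rw [yosidaExp, yosidaExp, yosidaExp, add_smul, NormedSpace.exp_add_of_commute hc,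
    smul_mul_smul_comm, ← Real.exp_add]
  congr 2
  ring

lemma commute_yosidaExp {R B : X →L[ℝ] X} (h : Commute R B) (l t : ℝ) :
    Commute (yosidaExp R l t) B := by
  have h1 : Commute (t • (l ^ 2 • R)) B := (h.smul_left _).smul_left _
  exact (h1.symm.exp_right.symm).smul_left _

/-- The path `s ↦ E(s) E'(t - s) u` joins `E'(t) u` to `E(t) u`; commutation makes its derivative
`E(s) E'(t - s) (B u - B' u)`, of norm at most `‖B u - B' u‖`. -/
lemma norm_apply_sub_le {E E' : ℝ → X →L[ℝ] X} {B B' : X →L[ℝ] X}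
    (hE : ∀ t, HasDerivAt E (E t * B) t) (hE' : ∀ t, HasDerivAt E' (E' t * B') t)
    (h0 : E 0 = 1) (h0' : E' 0 = 1) (h1 : ∀ t, 0 ≤ t → ‖E t‖ ≤ 1) (h1' : ∀ t, 0 ≤ t → ‖E' t‖ ≤ 1)
    (hc : ∀ t, Commute (E' t) B) (u : X) {t : ℝ} (ht : 0 ≤ t) :
    ‖E t u - E' t u‖ ≤ t * ‖B u - B' u‖ := by
  have hd : ∀ s, HasDerivAt (fun s => (E s * E' (t - s)) u)
      ((E s * E' (t - s)) (B u - B' u)) s := by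
    intro s
    have h2 : HasDerivAt (fun s => E' (t - s)) (-(E' (t - s) * B')) s :=
      ((hE' (t - s)).scomp s ((hasDerivAt_id s).const_sub t)).congr_deriv (by simp)
    have h3 := ((hE s).mul h2).clm_apply (hasDerivAt_const s u)
    refine h3.congr_deriv ?_
    have e : B (E' (t - s) u) = E' (t - s) (B u) := DFunLike.congr_fun (hc (t - s)).eq.symm u
    change E s (B (E' (t - s) u)) + E s (-(E' (t - s) (B' u))) + (E s * E' (t - s)) 0 =
      E s (E' (t - s) (B u - B' u))
    rw [e, map_neg, map_zero, add_zero, map_sub (E' (t - s)), map_sub (E s), ← sub_eq_add_neg]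
  have h4 := norm_image_sub_le_of_norm_deriv_right_le_segment (a := 0) (b := t)
    (C := ‖B u - B' u‖) (fun s _ => (hd s).continuousAt.continuousWithinAt)
    (fun s _ => (hd s).hasDerivWithinAt) (fun s hs => by
      rw [mul_apply_eq_comp]
      exact (norm_apply_le_of_le_one (h1 s hs.1) _).trans
        (norm_apply_le_of_le_one (h1' _ (sub_nonneg.2 hs.2.le)) _)) t ⟨ht, le_rfl⟩
  simpa [h0, h0', mul_comm] using h4

lemma norm_apply_sub_self_le {E : ℝ → X →L[ℝ] X} {B : X →L[ℝ] X}
    (hE : ∀ t, HasDerivAt E (E t * B) t) (h0 : E 0 = 1) (h1 : ∀ t, 0 ≤ t → ‖E t‖ ≤ 1)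
    (u : X) {t : ℝ} (ht : 0 ≤ t) : ‖E t u - u‖ ≤ t * ‖B u‖ := by
  simpa using norm_apply_sub_le (E' := fun _ => 1) (B' := 0) hE
    (fun t => by simpa using hasDerivAt_const t (1 : X →L[ℝ] X)) h0 rfl h1
    (fun _ _ => ContinuousLinearMap.norm_id_le) (fun _ => Commute.one_left _) u ht

/-- The derivative of `E(s) u - s B u` is `(E(s) - 1) B u`. No bound on `B (B u)` is available in
the application, so `B u` is replaced by a nearby `p` at cost `2 ‖B u - p‖`, and `(E(s) - 1) p` is
at most `s ‖B p‖`. The resulting bound is uniform enough to pass to the limit of Yosida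
approximations. -/
lemma norm_apply_sub_sub_le {E : ℝ → X →L[ℝ] X} {B : X →L[ℝ] X}
    (hE : ∀ t, HasDerivAt E (E t * B) t) (h0 : E 0 = 1) (h1 : ∀ t, 0 ≤ t → ‖E t‖ ≤ 1)
    (u p : X) {t : ℝ} (ht : 0 ≤ t) :
    ‖E t u - u - t • B u‖ ≤ t * (2 * ‖B u - p‖ + t * ‖B p‖) := by
  have hd : ∀ s, HasDerivAt (fun s => E s u - s • B u) (E s (B u) - B u) s := by
    intro s
    have h3 := ((hE s).clm_apply (hasDerivAt_const s u)).sub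
      ((hasDerivAt_id s).smul_const (B u))
    exact h3.congr_deriv (by simp)
  have h4 := norm_image_sub_le_of_norm_deriv_right_le_segment (a := 0) (b := t)
    (C := 2 * ‖B u - p‖ + t * ‖B p‖) (fun s _ => (hd s).continuousAt.continuousWithinAt)
    (fun s _ => (hd s).hasDerivWithinAt) (fun s hs => by
      have e : E s (B u) - B u = E s (B u - p) + (E s p - p) - (B u - p) := by
        rw [map_sub]; abel
      have h5 := norm_apply_sub_self_le hE h0 h1 p hs.1
      have h6 := norm_apply_le_of_le_one (h1 s hs.1) (B u - p)
      have h7 : s * ‖B p‖ ≤ t * ‖B p‖ := by gcongr; exact hs.2.le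
      rw [e]
      refine (norm_sub_le _ _).trans ?_
      linarith [norm_add_le (E s (B u - p)) (E s p - p)]) t ⟨ht, le_rfl⟩
  have e2 : E t u - u - t • B u = E t u - t • B u - u := by abel
  rw [e2]
  simpa [h0, mul_comm] using h4

variable [CompleteSpace X]

/-- The Hille–Yosida theorem for contraction semigroups, with resolvents given along a sequence
tending to infinity. -/
theorem hille_yosida {A : X →ₗ.[ℝ] X} (hA : Dense (A.domain : Set X)) {l : ℕ → ℝ}
    (hl : ∀ n, 0 < l n) (hlim : Tendsto l atTop atTop) {R : ℕ → X →L[ℝ] X}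
    (hR : ∀ n, ‖R n‖ ≤ (l n)⁻¹) (hright : ∀ n f, (R n f, l n • R n f - f) ∈ A.graph)
    (hleft : ∀ n u v, (u, v) ∈ A.graph → R n (l n • u - v) = u) :
    ∃ T : ℝ → X →L[ℝ] X, IsC0Semigroup T ∧ IsGeneratorOf A T ∧ (∀ t, 0 < t → ‖T t‖ ≤ 1) ∧
      ∀ t, 0 < t → ∀ u, Tendsto (fun n => yosidaExp (R n) (l n) t u) atTop (𝓝 (T t u)) := by
  have hD : ∀ u ∈ (A.domain : Set X), ∃ v, (u, v) ∈ A.graph := fun u hu =>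
    LinearPMap.mem_domain_iff.1 hu
  set E : ℕ → ℝ → X →L[ℝ] X := fun n => yosidaExp (R n) (l n) with hEdef
  set B : ℕ → X →L[ℝ] X := fun n => l n ^ 2 • R n - l n • 1 with hB
  have hE : ∀ n t, HasDerivAt (E n) (E n t * B n) t := fun n => hasDerivAt_yosidaExp _ _
  have hE0 : ∀ n, E n 0 = 1 := fun n => yosidaExp_zero _ _
  have hE1 : ∀ n t, 0 ≤ t → ‖E n t‖ ≤ 1 := fun n t => norm_yosidaExp_le (hl n) (hR n)
  have hlR1 : ∀ n, ‖l n • R n‖ ≤ 1 := fun n => by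
    rw [norm_smul, Real.norm_of_nonneg (hl n).le]
    calc l n * ‖R n‖ ≤ l n * (l n)⁻¹ := by gcongr; exacts [(hl n).le, hR n]
      _ = 1 := mul_inv_cancel₀ (hl n).ne'
  have hRv : ∀ n u v, (u, v) ∈ A.graph → l n • R n u = u + R n v := fun n u v h => by
    have := hleft n u v h
    rw [map_sub, map_smul, sub_eq_iff_eq_add] at this
    exact this
  have hlR : ∀ f, Tendsto (fun n => (l n • R n) f) atTop (𝓝 f) := by
    refine tendsto_self_of_dense (Eventually.of_forall hlR1) hA fun u hu => ?_
    obtain ⟨v, hv⟩ := hD u hu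
    have h1 : Tendsto (fun n => R n v) atTop (𝓝 0) := by
      have h2 : Tendsto (fun n => (l n)⁻¹ * ‖v‖) atTop (𝓝 0) := by
        simpa using (tendsto_inv_atTop_zero.comp hlim).mul_const ‖v‖
      exact squeeze_zero_norm (fun n => (R n).le_of_opNorm_le (hR n) v) h2
    have h3 := h1.const_add u
    rw [add_zero] at h3
    exact h3.congr fun n => (hRv n u v hv).symm
  have hBv : ∀ n u v, (u, v) ∈ A.graph → B n u = (l n • R n) v := fun n u v h => by
    simp only [hB, sub_apply, smul_apply, one_apply_eq_self]
    rw [pow_two, mul_smul, hRv n u v h, smul_add]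
    abel
  have hBlim : ∀ u v, (u, v) ∈ A.graph → Tendsto (fun n => B n u) atTop (𝓝 v) := fun u v h =>
    (hlR v).congr fun n => (hBv n u v h).symm
  -- The resolvent identity. It gives commutation of the resolvents, by exchanging the roles of `n`
  -- and `m` and cancelling `l m - l n` when this is nonzero.
  have hRR : ∀ n m f, R n f - R m f = (l m - l n) • R n (R m f) := fun n m f => by
    have := hleft n _ _ (hright m f)
    have e : l n • R m f - (l m • R m f - f) = f - (l m - l n) • R m f := by
      rw [sub_smul]; abel
    rw [e, map_sub, map_smul] at this
    rw [sub_eq_iff_eq_add, ← sub_eq_iff_eq_add']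
    exact this
  have hcomm : ∀ n m, Commute (R n) (R m) := fun n m => by
    by_cases h : l m = l n
    · have : R n = R m := by
        ext f
        have := hRR n m f
        rwa [h, sub_self, zero_smul, sub_eq_zero] at this
      rw [this]
    · refine ContinuousLinearMap.ext fun f => ?_
      have h1 := hRR n m f
      have h2 := hRR m n f
      rw [← neg_sub (R n f), h1, ← neg_sub (l m), neg_smul, neg_inj] at h2
      exact smul_right_injective X (sub_ne_zero.2 h) h2
  have hcB : ∀ n m t, Commute (E n t) (B m) := fun n m t =>
    commute_yosidaExp (((hcomm n m).smul_right _).sub_right ((Commute.one_right _).smul_right _)) _ _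
  have hcauchy : ∀ t, 0 ≤ t → ∀ u, CauchySeq fun n => E n t u := by
    intro t ht
    refine cauchySeq_of_dense (fun n => hE1 n t ht) hA fun u hu => ?_
    obtain ⟨v, hv⟩ := hD u hu
    refine Metric.cauchySeq_iff.2 fun ε hε => ?_
    obtain ⟨N, hN⟩ := Metric.cauchySeq_iff.1 (hBlim u v hv).cauchySeq (ε / (t + 1)) (by positivity)
    refine ⟨N, fun m hm n hn => ?_⟩
    have h1 := hN m hm n hn
    rw [dist_eq_norm] at h1 ⊢
    rw [lt_div_iff₀ (by positivity)] at h1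
    have h2 := norm_apply_sub_le (hE m) (hE n) (hE0 m) (hE0 n) (hE1 m) (hE1 n)
      (fun s => hcB n m s) u ht
    nlinarith [norm_nonneg (B m u - B n u)]
  have hT : ∀ t, ∃ M : X →L[ℝ] X, 0 ≤ t → (‖M‖ ≤ 1 ∧
      ∀ u, Tendsto (fun n => E n t u) atTop (𝓝 (M u))) := fun t => by
    by_cases ht : 0 ≤ t
    · obtain ⟨M, hM⟩ := exists_limit_of_norm_le_one (l := atTop) (fun n => hE1 n t ht)
        fun u => cauchySeq_tendsto_of_complete (hcauchy t ht u)
      exact ⟨M, fun _ => hM⟩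
    · exact ⟨0, fun h => absurd h ht⟩
  choose T hT using hT
  have hT1 : ∀ t, 0 < t → ‖T t‖ ≤ 1 := fun t ht => (hT t ht.le).1
  have hTt : ∀ t, 0 ≤ t → ∀ u, Tendsto (fun n => E n t u) atTop (𝓝 (T t u)) :=
    fun t ht => (hT t ht).2
  have hsub : ∀ u v p q, (u, v) ∈ A.graph → (p, q) ∈ A.graph → ∀ t, 0 ≤ t →
      ‖T t u - u - t • v‖ ≤ t * (2 * ‖v - p‖ + t * ‖q‖) := by
    intro u v p q huv hpq t ht
    refine le_of_tendsto_of_tendsto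
      (((hTt t ht u).sub_const u).sub ((hBlim u v huv).const_smul t)).norm
      (((((hBlim u v huv).sub_const p).norm.const_mul 2).add
        ((hBlim p q hpq).norm.const_mul t)).const_mul t) (Eventually.of_forall fun n => ?_)
    exact norm_apply_sub_sub_le (hE n) (hE0 n) (hE1 n) u p ht
  have hgen : ∀ u v, (u, v) ∈ A.graph → GeneratesAt T u v := by
    intro u v huv
    refine Metric.tendsto_nhds.2 fun ε hε => ?_
    -- The error in `hsub`, divided by `t`, is below `2 · ε / 4 + ε / 4`.
    obtain ⟨p, hpD, hp⟩ := hA.exists_dist_lt v (ε := ε / 4) (by positivity)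
    obtain ⟨q, hq⟩ := hD p hpD
    have hev : ∀ᶠ t : ℝ in 𝓝[>] 0, t < ε / 4 / (‖q‖ + 1) :=
      nhdsWithin_le_nhds (isOpen_Iio.mem_nhds (by
        change (0 : ℝ) < _
        positivity))
    filter_upwards [self_mem_nhdsWithin, hev] with t (ht : 0 < t) ht'
    rw [lt_div_iff₀ (by positivity)] at ht'
    rw [dist_eq_norm] at hp ⊢
    have e : t⁻¹ • (T t u - u) - v = t⁻¹ • (T t u - u - t • v) := by
      rw [smul_sub t⁻¹ (T t u - u), inv_smul_smul₀ ht.ne']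
    have h1 := hsub u v p q huv hq t ht.le
    rw [e, norm_smul, Real.norm_of_nonneg (inv_nonneg.2 ht.le), inv_mul_lt_iff₀ ht]
    refine h1.trans_lt ?_
    gcongr
    nlinarith [norm_nonneg q]
  have hC0 : IsC0Semigroup T := by
    refine ⟨fun s t hs ht => ContinuousLinearMap.ext fun u => ?_, fun u => ?_⟩
    · refine tendsto_nhds_unique (hTt (s + t) (add_pos hs ht).le u) ?_
      refine (tendsto_apply_of_norm_le_one (Eventually.of_forall fun n => hE1 n s hs.le)
        (hTt t ht.le u) (hTt s hs.le (T t u))).congr fun n => ?_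
      rw [hEdef]
      simp only [yosidaExp_add, mul_apply_eq_comp]
    · refine tendsto_self_of_dense (l := 𝓝[>] 0) ?_ hA (fun u hu => ?_) u
      · filter_upwards [self_mem_nhdsWithin] with t ht using hT1 t ht
      · obtain ⟨v, hv⟩ := hD u hu
        have h0 : Tendsto (fun t : ℝ => t) (𝓝[>] 0) (𝓝 0) := nhdsWithin_le_nhds
        have h1 := (h0.smul (hgen u v hv)).const_add u
        rw [zero_smul, add_zero] at h1
        refine h1.congr' ?_
        filter_upwards [self_mem_nhdsWithin] with t (ht : 0 < t)
        rw [smul_inv_smul₀ ht.ne']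
        abel
  refine ⟨T, hC0, fun u v => ⟨hgen u v, fun h => ?_⟩, hT1, fun t ht => hTt t ht.le⟩
  have h' : GeneratesAt T u v := h
  -- The generator of `T` extends `A`; equality holds because `l 0 - A` is already surjective while
  -- `l 0` minus the generator of a contraction semigroup is injective.
  have hr := hright 0 (l 0 • u - v)
  have h1 := h'.sub (hgen _ _ hr)
  have h2 := h1.mul_norm_le hT1 (l 0)
  have e : l 0 • (u - R 0 (l 0 • u - v)) - (v - (l 0 • R 0 (l 0 • u - v) - (l 0 • u - v))) = 0 := by
    rw [smul_sub]; abel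
  rw [e, norm_zero] at h2
  have h3 : ‖u - R 0 (l 0 • u - v)‖ ≤ 0 := nonpos_of_mul_nonpos_right h2 (hl 0)
  have h4 : R 0 (l 0 • u - v) = u := by
    rw [norm_le_zero_iff, sub_eq_zero] at h3
    exact h3.symm
  rw [h4] at hr
  simpa using hr

end HilleYosida

/-! ### Positivity of series, exponentials and integrals -/

namespace SATraceClass

variable {ℋ : Type*} [NormedAddCommGroup ℋ] [InnerProductSpace ℂ ℋ] [CompleteSpace ℋ]

lemma hasSum_apply_nonneg {ι : Type*} {f : ι → SATraceClass ℋ →L[ℝ] SATraceClass ℋ}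
    {L : SATraceClass ℋ →L[ℝ] SATraceClass ℋ} (h : HasSum f L)
    (hf : ∀ i u, 0 ≤ u → 0 ≤ f i u) {u : SATraceClass ℋ} (hu : 0 ≤ u) : 0 ≤ L u := by
  rw [nonneg_iff_quad]
  intro x
  have h1 := (h.mapL (ContinuousLinearMap.apply ℝ (SATraceClass ℋ) u)).mapL (quadCLM x)
  exact h1.nonneg fun i => nonneg_iff_quad.1 (hf i u hu) x

lemma pow_apply_nonneg {B : SATraceClass ℋ →L[ℝ] SATraceClass ℋ} (hB : ∀ u, 0 ≤ u → 0 ≤ B u)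
    (n : ℕ) {u : SATraceClass ℋ} (hu : 0 ≤ u) : 0 ≤ (B ^ n) u := by
  induction n with
  | zero => simpa using hu
  | succ n ih =>
    rw [pow_succ', mul_apply_eq_comp]
    exact hB _ ih

lemma yosidaExp_apply_nonneg {R : SATraceClass ℋ →L[ℝ] SATraceClass ℋ}
    (hR : ∀ u, 0 ≤ u → 0 ≤ R u) (l : ℝ) {t : ℝ} (ht : 0 ≤ t) {u : SATraceClass ℋ} (hu : 0 ≤ u) :
    0 ≤ yosidaExp R l t u := by
  refine smul_nonneg' (Real.exp_pos _).le ?_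
  refine hasSum_apply_nonneg (NormedSpace.exp_series_hasSum_exp' (𝕂 := ℝ) (t • (l ^ 2 • R)))
    (fun n v hv => smul_nonneg' (by positivity) (pow_apply_nonneg (fun w hw => ?_) n hv)) hu
  exact smul_nonneg' ht (smul_nonneg' (by positivity) (hR w hw))

/-- The Neumann series of a positive operator. -/
lemma exists_positive_inverse {B : SATraceClass ℋ →L[ℝ] SATraceClass ℋ}
    (hB : ∀ u, 0 ≤ u → 0 ≤ B u) (hB1 : ‖B‖ < 1) :
    ∃ Q : SATraceClass ℋ →L[ℝ] SATraceClass ℋ, (∀ u, 0 ≤ u → 0 ≤ Q u) ∧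
      (∀ f, Q f - B (Q f) = f) ∧ ∀ f, Q (f - B f) = f := by
  refine ⟨∑' n, B ^ n, fun u hu => ?_, fun f => ?_, fun f => ?_⟩
  · exact hasSum_apply_nonneg (summable_geometric_of_norm_lt_one hB1).hasSum
      (fun n v hv => pow_apply_nonneg hB n hv) hu
  · exact DFunLike.congr_fun (mul_neg_geom_series B hB1) f
  · exact DFunLike.congr_fun (geom_series_mul_neg B hB1) f

lemma integral_nonneg {g : ℝ → SATraceClass ℋ} (hg : Continuous g) (h : ∀ s, 0 ≤ g s) {t : ℝ}
    (ht : 0 ≤ t) : 0 ≤ ∫ s in (0 : ℝ)..t, g s := by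
  rw [nonneg_iff_quad]
  intro x
  rw [← quadCLM_apply, ← ContinuousLinearMap.intervalIntegral_comp_comm _
    (hg.intervalIntegrable _ _)]
  exact intervalIntegral.integral_nonneg ht fun s _ => nonneg_iff_quad.1 (h s) x

end SATraceClass

/-! ### Comparison of positive semigroups, and resolvents -/

section Semigroups

open SATraceClass

variable {ℋ : Type*} [NormedAddCommGroup ℋ] [InnerProductSpace ℂ ℋ] [CompleteSpace ℋ]

lemma PositiveSemigroup.extendOne_nonneg {T : ℝ → SATraceClass ℋ →L[ℝ] SATraceClass ℋ}
    (hT : PositiveSemigroup T) (t : ℝ) {u : SATraceClass ℋ} (hu : 0 ≤ u) :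
    0 ≤ extendOne T t u := by
  by_cases ht : 0 < t
  · rw [extendOne_of_pos T ht]
    exact hT t ht u hu
  · rwa [extendOne_of_nonpos T (not_lt.1 ht)]

/-- Comparison of positive semigroups through their generators on positive elements. -/
lemma PositiveSemigroup.apply_le_apply {T T' : ℝ → SATraceClass ℋ →L[ℝ] SATraceClass ℋ}
    (hT : IsC0Semigroup T) (hTp : PositiveSemigroup T) (hT' : IsC0Semigroup T')
    (hTp' : PositiveSemigroup T')
    (h : ∀ u v, 0 ≤ u → GeneratesAt T u v → ∃ w, GeneratesAt T' u w ∧ v ≤ w)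
    {t : ℝ} (ht : 0 < t) {u : SATraceClass ℋ} (hu : 0 ≤ u) : T t u ≤ T' t u := by
  have key : ∀ u v, 0 ≤ u → GeneratesAt T u v → 0 ≤ (T' t - T t) u := by
    intro u v hu hv
    rw [nonneg_iff_quad]
    intro x
    -- Tested against a vector `x`, the Duhamel curve becomes a real function whose right derivative
    -- is `-⟪x, T'(t - s) (w - v) x⟫ ≤ 0`.
    have hd : ∀ s ∈ Set.Ico 0 t, ∃ d ≤ 0, HasDerivWithinAt
        (fun s => quadCLM x (extendOne T' (t - s) (extendOne T s u))) d (Set.Ici s) s := by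
      intro s hs
      have h1 := hT.generatesAt_extendOne hv hs.1
      obtain ⟨w, hw, hvw⟩ := h _ _ (hTp.extendOne_nonneg s hu) h1
      have h2 := hT.hasDerivWithinAt_comp hT' hs.1 hs.2 h1 hw
      refine ⟨_, ?_, (quadCLM x).hasFDerivAt.comp_hasDerivWithinAt s h2⟩
      rw [← neg_sub w, map_neg, map_neg, neg_nonpos]
      exact nonneg_iff_quad.1 (hTp'.extendOne_nonneg _ (sub_nonneg.2 hvw)) x
    choose! d hd0 hd using hd
    have h3 := image_le_of_deriv_right_le_deriv_boundary
      ((quadCLM x).continuous.comp_continuousOn (hT.continuousOn_comp hT' u t (Set.Icc 0 t)))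
      hd (B := fun _ => quadCLM x (extendOne T' (t - 0) (extendOne T 0 u))) (B' := fun _ => 0)
      le_rfl continuousOn_const (fun s _ => hasDerivWithinAt_const _ _ _) hd0 ⟨ht.le, le_rfl⟩
    simp only [Function.comp_apply, sub_self, extendOne_zero, one_apply_eq_self, sub_zero,
      extendOne_of_pos _ ht] at h3
    rw [← quadCLM_apply, sub_apply, map_sub]
    exact sub_nonneg.2 h3
  -- A general `u ≥ 0` is the limit of its orbit averages, which are positive and lie in the domain
  -- of the generator.
  rw [← sub_nonneg]
  refine isClosed_nonneg.mem_of_tendsto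
    (((T' t - T t).continuous.tendsto u).comp (hT.tendsto_average u)) ?_
  filter_upwards [self_mem_nhdsWithin] with τ (hτ : 0 < τ)
  exact key _ _ (smul_nonneg' (inv_nonneg.2 hτ.le) (integral_nonneg (hT.continuous_extendOne u)
    (fun s => hTp.extendOne_nonneg s hu) hτ.le)) ((hT.generatesAt_integral u hτ.le).const_smul _)

/-- The Laplace transform of `S` at `f`, without an improper integral: for `P t = e^{-lt} S t` it is
`∫₀¹ P s (Q f) ds` with `Q = (1 - P 1)⁻¹`. The generator of `P` maps this integral to `P 1 (Q f) - Q
f = -f`, and undoing the rescaling adds `l • w`. -/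
lemma IsDynamicalSemigroup.exists_generatesAt {S : ℝ → SATraceClass ℋ →L[ℝ] SATraceClass ℋ}
    (hS : IsDynamicalSemigroup S) {l : ℝ} (hl : 0 < l) (f : SATraceClass ℋ) :
    ∃ w, GeneratesAt S w (l • w - f) ∧ (0 ≤ f → 0 ≤ w) := by
  set P : ℝ → SATraceClass ℋ →L[ℝ] SATraceClass ℋ := fun t => Real.exp (-(l * t)) • S t with hP
  have hPC : IsC0Semigroup P := hS.isC0Semigroup.exp_smul l
  have hPp : PositiveSemigroup P := fun t ht u hu =>
    smul_nonneg' (Real.exp_pos _).le (hS.positive t ht u hu)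
  have hP1 : ‖P 1‖ < 1 := by
    have h1 : Real.exp (-(l * 1)) < 1 := Real.exp_lt_one_iff.2 (by linarith)
    rw [hP, norm_smul, Real.norm_of_nonneg (Real.exp_pos _).le]
    have h2 := hS.contraction 1 one_pos
    have h3 := Real.exp_pos (-(l * 1))
    nlinarith
  obtain ⟨Q, hQp, hQ, -⟩ := exists_positive_inverse (hPp 1 one_pos) hP1
  have h1 := hPC.generatesAt_integral (Q f) zero_le_one
  rw [extendOne_of_pos P one_pos, ← neg_sub, hQ f] at h1
  refine ⟨_, ?_, fun hf => integral_nonneg (hPC.continuous_extendOne _)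
    (fun s => hPp.extendOne_nonneg s (hQp f hf)) zero_le_one⟩
  have h2 := hS.isC0Semigroup.generatesAt_of_exp_smul h1
  rwa [neg_add_eq_sub] at h2

lemma mem_graph_neg_iff {X : Type*} [NormedAddCommGroup X] [NormedSpace ℝ X] {A : X →ₗ.[ℝ] X}
    {u v : X} : (u, v) ∈ (-A).graph ↔ ∃ y : A.domain, (y : X) = u ∧ A y = -v := by
  rw [LinearPMap.mem_graph_iff]
  refine exists_congr fun y => and_congr_right fun _ => ?_
  rw [LinearPMap.neg_apply, neg_eq_iff_eq_neg]

lemma IsGeneratorOf.generatesAt {X : Type*} [NormedAddCommGroup X] [NormedSpace ℝ X]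
    {A : X →ₗ.[ℝ] X} {T : ℝ → X →L[ℝ] X} (h : IsGeneratorOf (-A) T) (y : A.domain) :
    GeneratesAt T y (-A y) :=
  (h _ _).1 (mem_graph_neg_iff.2 ⟨y, rfl, (neg_neg _).symm⟩)

lemma IsGeneratorOf.exists_of_generatesAt {X : Type*} [NormedAddCommGroup X] [NormedSpace ℝ X]
    {A : X →ₗ.[ℝ] X} {T : ℝ → X →L[ℝ] X} (h : IsGeneratorOf (-A) T) {u v : X}
    (huv : GeneratesAt T u v) : ∃ y : A.domain, (y : X) = u ∧ A y = -v :=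
  mem_graph_neg_iff.1 ((h _ _).2 huv)

/-! ### Positive perturbations of the generator -/

section Perturbation

variable {H : SATraceClass ℋ →ₗ.[ℝ] SATraceClass ℋ}
  {S : ℝ → SATraceClass ℋ →L[ℝ] SATraceClass ℋ}

/-- The resolvent `(l + H)⁻¹` as a map into the domain of `H`. -/
lemma IsDynamicalSemigroup.exists_resolvent (hS : IsDynamicalSemigroup S)
    (hH : IsGeneratorOf (-H) S) {l : ℝ} (hl : 0 < l) :
    ∃ R : SATraceClass ℋ →ₗ[ℝ] H.domain, (∀ f, l • (R f : SATraceClass ℋ) + H (R f) = f) ∧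
      (∀ y : H.domain, R (l • (y : SATraceClass ℋ) + H y) = y) ∧
      ∀ f, 0 ≤ f → 0 ≤ (R f : SATraceClass ℋ) := by
  let M : H.domain →ₗ[ℝ] SATraceClass ℋ := l • H.domain.subtype + H.toFun
  have hM : ∀ y : H.domain, M y = l • (y : SATraceClass ℋ) + H y := fun _ => rfl
  have hinj : Function.Injective M := by
    rw [injective_iff_map_eq_zero]
    intro y hy
    have h1 := (hH.generatesAt y).mul_norm_le hS.contraction l
    rw [sub_neg_eq_add, ← hM, hy, norm_zero] at h1
    have h2 := nonpos_of_mul_nonpos_right h1 hl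
    exact Subtype.ext (norm_le_zero_iff.1 h2)
  have hsurj : ∀ f, ∃ y : H.domain, M y = f ∧ (0 ≤ f → 0 ≤ (y : SATraceClass ℋ)) := by
    intro f
    obtain ⟨w, hw, hw0⟩ := hS.exists_generatesAt hl f
    obtain ⟨y, rfl, hy⟩ := hH.exists_of_generatesAt hw
    exact ⟨y, by rw [hM, hy]; abel, hw0⟩
  let e := LinearEquiv.ofBijective M ⟨hinj, fun f => (hsurj f).imp fun _ h => h.1⟩
  refine ⟨e.symm, fun f => ?_, fun y => ?_, fun f hf => ?_⟩
  · exact e.apply_symm_apply f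
  · exact e.symm_apply_apply y
  · obtain ⟨y, hy, hy0⟩ := hsurj f
    have : e.symm f = y := by rw [← hy]; exact e.symm_apply_apply y
    change 0 ≤ ((e.symm f : H.domain) : SATraceClass ℋ)
    rw [this]
    exact hy0 hf

/-- Resolvents of a relatively bounded positive perturbation. -/
lemma IsDynamicalSemigroup.exists_resolvent_sub (hS : IsDynamicalSemigroup S)
    (hH : IsGeneratorOf (-H) S) {L : H.domain →ₗ[ℝ] SATraceClass ℋ} (hL : PositivityPreserving L)
    (hLH : ∀ u : H.domain, 0 ≤ (u : SATraceClass ℋ) → (L u).tr ≤ (H u).tr) {a b : ℝ}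
    (ha : 0 ≤ a) (hb : 0 ≤ b) (hab : ∀ u : H.domain, 0 ≤ (u : SATraceClass ℋ) →
      (L u).tr ≤ a * (u : SATraceClass ℋ).tr + b * (H u).tr)
    {l : ℝ} (hl : 0 < l) (hlab : b + a * l⁻¹ < 1) :
    ∃ R : SATraceClass ℋ →L[ℝ] SATraceClass ℋ, ‖R‖ ≤ l⁻¹ ∧
      (∀ f, (R f, l • R f - f) ∈ (-(subOnDomain H L)).graph) ∧
      (∀ u v, (u, v) ∈ (-(subOnDomain H L)).graph → R (l • u - v) = u) ∧
      ∀ f, 0 ≤ f → 0 ≤ R f := by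
  obtain ⟨R, hR, hR', hRp⟩ := hS.exists_resolvent hH hl
  have hBp : ∀ f, 0 ≤ f → 0 ≤ (L ∘ₗ R) f := fun f hf => hL _ (hRp f hf)
  -- For `f ≥ 0`, `l tr (R f) + tr (H (R f)) = tr f` with both summands nonnegative, the second
  -- since it dominates `tr (L (R f)) ≥ 0`. So `tr (R f) ≤ l⁻¹ tr f` and `tr (H (R f)) ≤ tr f`,
  -- which enter the relative bound.
  have hBtr : ∀ f, 0 ≤ f → tr ((L ∘ₗ R) f) ≤ (b + a * l⁻¹) * tr f := by
    intro f hf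
    have h1 : l * tr (R f : SATraceClass ℋ) + tr (H (R f)) = tr f := by
      rw [← tr_smul, ← tr_add, hR]
    have h2 : 0 ≤ tr (H (R f)) := (tr_nonneg (hBp f hf)).trans (hLH _ (hRp f hf))
    have h3 := tr_nonneg (hRp f hf)
    have h4 : tr (R f : SATraceClass ℋ) ≤ l⁻¹ * tr f := by
      rw [le_inv_mul_iff₀ hl]; linarith
    have h5 : tr (H (R f)) ≤ tr f := by
      have := mul_nonneg hl.le h3
      linarith
    refine (hab _ (hRp f hf)).trans ?_
    have h6 := mul_le_mul_of_nonneg_left h4 ha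
    have h7 := mul_le_mul_of_nonneg_left h5 hb
    linarith
  have hBn := norm_map_le_of_tr_le hBp hBtr
  have hc0 : 0 ≤ b + a * l⁻¹ := by positivity
  let B := (L ∘ₗ R).mkContinuous _ hBn
  obtain ⟨Q, hQp, hQ, hQ'⟩ := exists_positive_inverse (B := B) hBp
    (((L ∘ₗ R).mkContinuous_norm_le hc0 hBn).trans_lt hlab)
  -- The perturbed resolvent `(l + H - L)⁻¹ = (l + H)⁻¹ (1 - L (l + H)⁻¹)⁻¹`.
  let R₁ : SATraceClass ℋ →ₗ[ℝ] SATraceClass ℋ := H.domain.subtype ∘ₗ R ∘ₗ Q.toLinearMap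
  have hR₁p : ∀ f, 0 ≤ f → 0 ≤ R₁ f := fun f hf => hRp _ (hQp f hf)
  have heq : ∀ f, l • (R (Q f) : SATraceClass ℋ) + (H (R (Q f)) - L (R (Q f))) = f := by
    intro f
    have h1 := hQ f
    change Q f - L (R (Q f)) = f at h1
    conv_rhs => rw [← h1]
    conv_rhs => lhs; rw [← hR (Q f)]
    abel
  -- Taking traces in `heq`, the term `tr (H ·) - tr (L ·)` is nonnegative and can be dropped. This
  -- gives the sharp constant `l⁻¹`, independent of `a` and `b`.
  have hR₁tr : ∀ f, 0 ≤ f → tr (R₁ f) ≤ l⁻¹ * tr f := by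
    intro f hf
    have h1 : l * tr (R₁ f) + (tr (H (R (Q f))) - tr (L (R (Q f)))) = tr f := by
      conv_rhs => rw [← heq f]
      rw [tr_add, tr_smul, tr_sub]
      rfl
    have h2 := hLH _ (hRp _ (hQp f hf))
    rw [le_inv_mul_iff₀ hl]
    linarith
  have hR₁n := norm_map_le_of_tr_le hR₁p hR₁tr
  refine ⟨R₁.mkContinuous _ hR₁n, R₁.mkContinuous_norm_le (inv_nonneg.2 hl.le) hR₁n,
    fun f => ?_, fun u v huv => ?_, hR₁p⟩
  · refine mem_graph_neg_iff.2 ⟨R (Q f), rfl, ?_⟩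
    change H (R (Q f)) - L (R (Q f)) = -(l • (R (Q f) : SATraceClass ℋ) - f)
    rw [neg_sub, eq_sub_iff_add_eq, add_comm]
    exact heq f
  · obtain ⟨y, rfl, hy⟩ := mem_graph_neg_iff.1 huv
    change H.domain at y
    change H y - L y = -v at hy
    change ((R (Q (l • (y : SATraceClass ℋ) - v)) : H.domain) : SATraceClass ℋ) = y
    have h1 : l • (y : SATraceClass ℋ) - v =
        (l • (y : SATraceClass ℋ) + H y) - B (l • (y : SATraceClass ℋ) + H y) := by
      change _ = _ - L (R _)
      rw [hR', add_sub_assoc, hy, sub_eq_add_neg]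
    rw [h1, hQ', hR']

lemma IsDynamicalSemigroup.exists_perturbation (hS : IsDynamicalSemigroup S)
    (hH : IsGeneratorOf (-H) S) {L : H.domain →ₗ[ℝ] SATraceClass ℋ} (hL : PositivityPreserving L)
    (hLH : ∀ u : H.domain, 0 ≤ (u : SATraceClass ℋ) → (L u).tr ≤ (H u).tr) {a b : ℝ}
    (ha : 0 ≤ a) (hb : 0 ≤ b) (hb1 : b < 1) (hab : ∀ u : H.domain, 0 ≤ (u : SATraceClass ℋ) →
      (L u).tr ≤ a * (u : SATraceClass ℋ).tr + b * (H u).tr) :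
    ∃ T : ℝ → SATraceClass ℋ →L[ℝ] SATraceClass ℋ,
      IsDynamicalSemigroup T ∧ IsGeneratorOf (-(subOnDomain H L)) T := by
  have hb0 : 0 < 1 - b := sub_pos.2 hb1
  -- Any `l > a / (1 - b)` satisfies `b + a / l < 1`.
  set l : ℕ → ℝ := fun n => n + (1 + a / (1 - b)) with hldef
  have hl : ∀ n, 0 < l n := fun n => by positivity
  have hlim : Tendsto l atTop atTop := tendsto_atTop_add_const_right _ _ tendsto_natCast_atTop_atTop
  have hlab : ∀ n, b + a * (l n)⁻¹ < 1 := fun n => by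
    have h1 : a < (1 - b) * l n := by
      have : (1 - b) * (a / (1 - b)) = a := mul_div_cancel₀ a hb0.ne'
      have h2 : 0 < (1 - b) * (n + 1) := by positivity
      calc a = (1 - b) * (a / (1 - b)) := this.symm
        _ < (1 - b) * (a / (1 - b)) + (1 - b) * (n + 1) := by linarith
        _ = (1 - b) * l n := by rw [hldef]; ring
    have h2 : a * (l n)⁻¹ < 1 - b := by
      rwa [← div_eq_mul_inv, div_lt_iff₀ (hl n)]
    linarith
  choose R hR hright hleft hRp using fun n =>
    hS.exists_resolvent_sub hH hL hLH ha hb hab (hl n) (hlab n)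
  have hdense : Dense ((-(subOnDomain H L)).domain : Set (SATraceClass ℋ)) := by
    refine hS.isC0Semigroup.dense_generatesAt.mono ?_
    rintro u ⟨v, hv⟩
    obtain ⟨y, rfl, -⟩ := hH.exists_of_generatesAt hv
    exact y.2
  obtain ⟨T, hT, hgen, hT1, hTlim⟩ := hille_yosida hdense hl hlim hR hright hleft
  refine ⟨T, ⟨hT, fun t ht u hu => ?_, hT1⟩, hgen⟩
  exact isClosed_nonneg.mem_of_tendsto (hTlim t ht u)
    (Eventually.of_forall fun n => yosidaExp_apply_nonneg (hRp n) _ ht.le hu)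

/-- It serves twice: with `L' = H - K_β` it gives monotonicity in the index, and with an arbitrary
extension `L'` of `H - K` it gives minimality. -/
lemma PositiveSemigroup.apply_le_apply_of_subOnDomain
    {T T' : ℝ → SATraceClass ℋ →L[ℝ] SATraceClass ℋ} {K L : H.domain →ₗ[ℝ] SATraceClass ℋ}
    {L' : SATraceClass ℋ →ₗ.[ℝ] SATraceClass ℋ}
    (hT : IsC0Semigroup T) (hTp : PositiveSemigroup T) (hgen : IsGeneratorOf (-(subOnDomain H L)) T)
    (hT' : IsC0Semigroup T') (hTp' : PositiveSemigroup T') (hgen' : IsGeneratorOf (-L') T')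
    (hLK : PositivityPreserving (K - L)) (hKL' : subOnDomain H K ≤ L')
    {t : ℝ} (ht : 0 < t) {u : SATraceClass ℋ} (hu : 0 ≤ u) : T t u ≤ T' t u := by
  refine PositiveSemigroup.apply_le_apply hT hTp hT' hTp' (fun u v hu huv => ?_) ht hu
  obtain ⟨y, rfl, hy⟩ := hgen.exists_of_generatesAt huv
  change H.domain at y
  change H y - L y = -v at hy
  refine ⟨-(H y - K y), ?_, ?_⟩
  · have h1 := hgen'.generatesAt ⟨y, hKL'.1 y.2⟩
    rw [← hKL'.2 (x := y) (y := ⟨y, hKL'.1 y.2⟩) rfl] at h1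
    exact h1
  · have h2 : 0 ≤ K y - L y := hLK y hu
    rw [eq_neg_iff_add_eq_zero, add_comm, ← eq_neg_iff_add_eq_zero] at hy
    rw [hy, ← sub_nonneg]
    convert h2 using 1
    abel

end Perturbation

/-! ### Increasing nets of dynamical semigroups -/

section Net

variable {J : Type*} [Preorder J] [IsDirectedOrder J] [Nonempty J]
  {Tα : J → ℝ → SATraceClass ℋ →L[ℝ] SATraceClass ℋ}

/-- An increasing net of dynamical semigroups converges strongly. -/
lemma exists_tendsto_of_monotone_semigroups (hdyn : ∀ α, IsDynamicalSemigroup (Tα α))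
    (hmono : ∀ t, 0 < t → ∀ u, 0 ≤ u → Monotone fun α => Tα α t u) :
    ∃ T : ℝ → SATraceClass ℋ →L[ℝ] SATraceClass ℋ,
      ∀ t, 0 < t → ∀ u, Tendsto (fun α => Tα α t u) atTop (𝓝 (T t u)) := by
  have h : ∀ t, ∃ M : SATraceClass ℋ →L[ℝ] SATraceClass ℋ,
      0 < t → ∀ u, Tendsto (fun α => Tα α t u) atTop (𝓝 (M u)) := by
    intro t
    by_cases ht : 0 < t
    · have hpos : ∀ u, 0 ≤ u → ∃ v, Tendsto (fun α => Tα α t u) atTop (𝓝 v) := fun u hu => by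
        refine exists_tendsto_of_monotone (hmono t ht u hu) (C := ‖u‖) fun α => ?_
        rw [← norm_of_nonneg ((hdyn α).positive t ht u hu)]
        exact norm_apply_le_of_le_one ((hdyn α).contraction t ht) u
      obtain ⟨M, -, hM⟩ := exists_limit_of_norm_le_one (l := atTop)
        (fun α => (hdyn α).contraction t ht) fun u => by
          obtain ⟨p, q, hp, hq, rfl, -⟩ := exists_sub_eq u
          obtain ⟨v, hv⟩ := hpos p hp
          obtain ⟨w, hw⟩ := hpos q hq
          exact ⟨v - w, (hv.sub hw).congr fun α => (map_sub _ _ _).symm⟩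
      exact ⟨M, fun _ => hM⟩
    · exact ⟨0, fun h => absurd h ht⟩
  choose T hT using h
  exact ⟨T, hT⟩

/-- The strong limit of an increasing net of dynamical semigroups is a dynamical semigroup. -/
lemma IsDynamicalSemigroup.of_tendsto (hdyn : ∀ α, IsDynamicalSemigroup (Tα α))
    (hmono : ∀ t, 0 < t → ∀ u, 0 ≤ u → Monotone fun α => Tα α t u)
    {T : ℝ → SATraceClass ℋ →L[ℝ] SATraceClass ℋ}
    (hlim : ∀ t, 0 < t → ∀ u, Tendsto (fun α => Tα α t u) atTop (𝓝 (T t u))) :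
    IsDynamicalSemigroup T := by
  have hpos : PositiveSemigroup T := fun t ht u hu => isClosed_nonneg.mem_of_tendsto (hlim t ht u)
    (Eventually.of_forall fun α => (hdyn α).positive t ht u hu)
  have hone : ∀ t, 0 < t → ‖T t‖ ≤ 1 := fun t ht => by
    refine ContinuousLinearMap.opNorm_le_bound _ zero_le_one fun u => ?_
    rw [one_mul]
    exact le_of_tendsto (hlim t ht u).norm (Eventually.of_forall fun α =>
      norm_apply_le_of_le_one ((hdyn α).contraction t ht) u)
  refine ⟨⟨fun s t hs ht => ContinuousLinearMap.ext fun u => ?_, fun u => ?_⟩, hpos, hone⟩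
  · refine tendsto_nhds_unique (hlim (s + t) (add_pos hs ht) u) ?_
    refine (tendsto_apply_of_norm_le_one (Eventually.of_forall fun α =>
      (hdyn α).contraction s hs) (hlim t ht u) (hlim s hs (T t u))).congr fun α => ?_
    rw [(hdyn α).isC0Semigroup.add s t hs ht, ContinuousLinearMap.comp_apply]
  · obtain ⟨α⟩ := ‹Nonempty J›
    -- Strong continuity at `0` needs just one index `α`: as `T^α_t u ≤ T_t u`, the norm of the
    -- difference is `‖T_t u‖ - ‖T^α_t u‖ ≤ ‖u‖ - ‖T^α_t u‖`, which tends to `0`.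
    have key : ∀ u, 0 ≤ u → Tendsto (fun t => T t u) (𝓝[>] 0) (𝓝 u) := by
      intro u hu
      have h1 := (hdyn α).isC0Semigroup.tendsto_zero u
      have h2 : Tendsto (fun t => T t u - Tα α t u) (𝓝[>] 0) (𝓝 0) := by
        have h3 : Tendsto (fun t => ‖u‖ - ‖Tα α t u‖) (𝓝[>] 0) (𝓝 0) := by
          simpa using h1.norm.const_sub ‖u‖
        refine squeeze_zero_norm' ?_ h3
        filter_upwards [self_mem_nhdsWithin] with t (ht : 0 < t)
        have hle : Tα α t u ≤ T t u := by
          rw [← sub_nonneg]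
          refine isClosed_nonneg.mem_of_tendsto ((hlim t ht u).sub_const (Tα α t u)) ?_
          filter_upwards [eventually_ge_atTop α] with β hβ
          exact sub_nonneg.2 (hmono t ht u hu hβ)
        rw [norm_sub_of_le hle, ← norm_of_nonneg (hpos t ht u hu),
          ← norm_of_nonneg ((hdyn α).positive t ht u hu)]
        gcongr
        exact norm_apply_le_of_le_one (hone t ht) u
      simpa using h2.add h1
    obtain ⟨p, q, hp, hq, rfl, -⟩ := exists_sub_eq u
    exact ((key p hp).sub (key q hq)).congr fun t => (map_sub _ _ _).symm

end Net

end Semigroups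

end

/-! ### Existence and minimality of the limit semigroup -/

theorem theorem2p8 {ℋ : Type*} [NormedAddCommGroup ℋ] [InnerProductSpace ℂ ℋ] [CompleteSpace ℋ]
    (H : SATraceClass ℋ →ₗ.[ℝ] SATraceClass ℋ)
    (S : ℝ → SATraceClass ℋ →L[ℝ] SATraceClass ℋ)
    (hS : IsDynamicalSemigroup S) (hH : IsGeneratorOf (-H) S)
    (K : H.domain →ₗ[ℝ] SATraceClass ℋ) (hK : PositivityPreserving K)
    (hKH : ∀ u : H.domain, 0 ≤ (u : SATraceClass ℋ) → (K u).tr ≤ (H u).tr)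
    {J : Type*} [Preorder J] [IsDirectedOrder J] [Nonempty J]
    (Kα : J → H.domain →ₗ[ℝ] SATraceClass ℋ) (hKα : IsFunctionalRegularisation H K Kα) :
    (∃ T, IsRegularisationLimit H Kα T) ∧
    ∀ T, IsRegularisationLimit H Kα T →
      IsDynamicalSemigroup T ∧
      ∀ (L' : SATraceClass ℋ →ₗ.[ℝ] SATraceClass ℋ)
        (T' : ℝ → SATraceClass ℋ →L[ℝ] SATraceClass ℋ),
        subOnDomain H K ≤ L' →
        IsC0Semigroup T' → PositiveSemigroup T' → IsGeneratorOf (-L') T' →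
        ∀ t : ℝ, 0 < t → OperatorLE (T t) (T' t) := by

  have hex : ∀ α, ∃ T : ℝ → SATraceClass ℋ →L[ℝ] SATraceClass ℋ,
      IsDynamicalSemigroup T ∧ IsGeneratorOf (-(subOnDomain H (Kα α))) T := by
    intro α
    obtain ⟨a, b, ha, hb, hb1, hab⟩ := hKα.relative_bound α
    refine hS.exists_perturbation hH (hKα.positive α) (fun u hu => ?_) ha hb hb1 hab
    exact (SATraceClass.tr_mono (sub_nonneg.1 (hKα.le α u hu))).trans (hKH u hu)
  choose T₀ hdyn hgen using hex
  have hmono : ∀ t, 0 < t → ∀ u, 0 ≤ u → Monotone fun α => T₀ α t u := fun t ht u hu α β hαβ =>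
    PositiveSemigroup.apply_le_apply_of_subOnDomain (hdyn α).isC0Semigroup (hdyn α).positive
      (hgen α) (hdyn β).isC0Semigroup (hdyn β).positive (hgen β) (hKα.monotone α β hαβ) le_rfl ht hu
  refine ⟨?_, fun T ⟨Tα, hTα, hTlim⟩ => ?_⟩
  · obtain ⟨T, hT⟩ := exists_tendsto_of_monotone_semigroups hdyn hmono
    exact ⟨T, T₀, fun α => ⟨(hdyn α).isC0Semigroup, hgen α⟩, hT⟩
  -- The semigroups supplied with `T` are only known to be `C₀`; uniqueness identifies them with the
  -- constructed ones, which are positive, contractive and increasing.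
  · have heq : ∀ α t, 0 < t → Tα α t = T₀ α t := fun α t ht =>
      (hTα α).1.eq_of_generatesAt (hdyn α).isC0Semigroup
        (fun u v h => (hgen α u v).1 (((hTα α).2 u v).2 h)) ht
    have hlim : ∀ t, 0 < t → ∀ u, Tendsto (fun α => T₀ α t u) atTop (𝓝 (T t u)) :=
      fun t ht u => (hTlim t ht u).congr fun α => by rw [heq α t ht]
    refine ⟨.of_tendsto hdyn hmono hlim, fun L' T' hL' hT' hTp' hgen' t ht u hu => ?_⟩
    refine SATraceClass.isClosed_nonneg.mem_of_tendsto ((hlim t ht u).const_sub (T' t u))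
      (Eventually.of_forall fun α => ?_)
    change 0 ≤ T' t u - T₀ α t u
    rw [sub_nonneg]
    exact PositiveSemigroup.apply_le_apply_of_subOnDomain (hdyn α).isC0Semigroup
      (hdyn α).positive (hgen α) hT' hTp' hgen' (hKα.le α) hL' ht hu
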